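/- Let $k$ be a field of characteristic zero. A \emph{triple} $\tau=(\mathfrak g,\mathfrak s,\mathfrak c)$ consists of a Lie algebra $\mathfrak g$ over $k$ (of arbitrary dimension), a subalgebra $\mathfrak s$ and a subspace $\mathfrak c$ with $\mathfrak g=\mathfrak s\oplus\mathfrak c$. It is \emph{hyporeductive} if $\mathfrak g=N_{\mathfrak g}(\mathfrak c)+\mathfrak c$, where $N_{\mathfrak g}(\mathfrak c)=\{x\in\mathfrak g : [x,\mathfrak c]\subseteq\mathfrak c\}$. Let $U_\tau=U(\mathfrak g)/U(\mathfrak g)\mathfrak s$ be the quotient coalgebra of the universal enveloping algebra, with unit $1=\bar 1$ and the bilinear product determined by $$\bar u\,\Big(\sum_{\sigma\in S_n}\overline{c_{\sigma(1)}\cdots c_{\sigma(n)}}\Big)=\sum_{\sigma\in S_n}\overline{c_{\sigma(1)}\cdots c_{\sigma(n)}\,u}\qquad(u\in U(\mathfrak g),\ n\ge 0,\ c_1,\dots,c_n\in\mathfrak c).$$ A \emph{non-associative Hopf algebra} is a coassociative, counital, cocommutative coalgebra $U$ with a (not necessarily associative) unital product such that $\Delta$ and $\epsilon$ are multiplicative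 and unital, together with bilinear divisions $\backslash$ and $/$ satisfying $$u_{(1)}\backslash(u_{(2)}v)=\epsilon(u)v=u_{(1)}(u_{(2)}\backslash v),\qquad (uv_{(1)})/v_{(2)}=\epsilon(v)u=(u/v_{(1)})v_{(2)}.$$ It is \emph{hyporeductive} if the following two properties hold. (i) Right hypospeciality: there is a coalgebra morphism $\circ: U\otimes U\to U$ with $u\circ 1=\epsilon(u)1=1\circ u$ and $$H(u,v)(xy)=H(u_{(1)},v_{(1)})(x)\;H'(u_{(2)},v_{(2)})(y)\qquad\text{for all }u,v,x,y\in U,$$ where $r(u,v)(x)=((xu_{(1)})v_{(1)})/(u_{(2)}v_{(2)})$, $H(u,v)(x)=r(u_{(1)},v_{(1)})(x)\,(u_{(2)}\circ v_{(2)})$ and $H'(u,v)(y)=(u_{(1)}\circ v_{(1)})\backslash H(u_{(2)},v_{(2)})(y)$. (ii) Right monoalternativity: $(((xy_{(1)})y_{(2)})\cdots)y_{(n)}=x((y_{(1)}y_{(2)})\cdots y_{(n)})$ for all $n\ge 0$ and $x,y\in U$. \textbf{Theorem.} If $\tau$ is a hyporeductive triple, then $U_\tau$, with the above coalgebra structure,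 product and unit, is a hyporeductive Hopf algebra (that is, it is a non-associative Hopf algebra, with suitable divisions, and it is hyporeductive). -/

import Mathlib

open scoped TensorProduct

/-! ### Sweedler-type products and non-associative Hopf algebras -/

section Sweedler

variable {k C M N P U : Type*} [Field k] [AddCommGroup C] [Module k C] [Coalgebra k C]
  [AddCommGroup M] [Module k M] [AddCommGroup N] [Module k N] [AddCommGroup P] [Module k P]
  [AddCommGroup U] [Module k U]

/-- The linear map `c ↦ ∑ B (f c₍₁₎) (g c₍₂₎)`, where `Δ c = ∑ c₍₁₎ ⊗ c₍₂₎`. -/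
noncomputable def sweedler (B : M →ₗ[k] N →ₗ[k] P) (f : C →ₗ[k] M) (g : C →ₗ[k] N) :
    C →ₗ[k] P :=
  TensorProduct.lift B ∘ₗ TensorProduct.map f g ∘ₗ Coalgebra.comul

/-- The linear map `c ↦ ∑ f c₍₁₎ ∘ g c₍₂₎` (apply `g c₍₂₎` first). -/
noncomputable def sweedlerComp (f g : C →ₗ[k] Module.End k U) : C →ₗ[k] Module.End k U :=
  sweedler (LinearMap.mul k (Module.End k U)) f g

/-- The linear map `c ↦ ∑ g c₍₂₎ ∘ f c₍₁₎` (apply `f c₍₁₎` first). -/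
noncomputable def sweedlerThen (f g : C →ₗ[k] Module.End k U) : C →ₗ[k] Module.End k U :=
  sweedler (LinearMap.mul k (Module.End k U)).flip f g

end Sweedler

/-- A non-associative Hopf algebra structure on a coassociative counital coalgebra `U`, in the
cocommutative setting: a unital product which is a morphism of coalgebras, a group-like unit, and
left and right divisions. Here `mul u v = u v`, `ldiv u v = u \ v` and `rdiv u v = u / v`. -/
structure NonassocHopfAlgebra (k U : Type*) [Field k] [AddCommGroup U] [Module k U]
    [Coalgebra k U] where
  mul : U →ₗ[k] U →ₗ[k] U
  one : U
  ldiv : U →ₗ[k] U →ₗ[k] U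
  rdiv : U →ₗ[k] U →ₗ[k] U
  cocomm : Coalgebra.IsCocomm k U
  one_mul : ∀ u, mul one u = u
  mul_one : ∀ u, mul u one = u
  counit_one : Coalgebra.counit (R := k) one = 1
  comul_one : Coalgebra.comul (R := k) one = one ⊗ₜ[k] one
  counit_mul : ∀ u v,
    Coalgebra.counit (R := k) (mul u v) = Coalgebra.counit (R := k) u * Coalgebra.counit (R := k) v
  /-- `Δ (u v) = ∑ u₍₁₎ v₍₁₎ ⊗ u₍₂₎ v₍₂₎` -/
  comul_mul : ∀ u v, Coalgebra.comul (R := k) (mul u v) =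
    TensorProduct.map (TensorProduct.lift mul) (TensorProduct.lift mul)
      (Coalgebra.comul (R := k) (u ⊗ₜ[k] v))
  /-- `∑ u₍₁₎ \ (u₍₂₎ v) = ε(u) v` -/
  ldiv_mul : ∀ u v, sweedlerComp ldiv mul u v = Coalgebra.counit (R := k) u • v
  /-- `∑ u₍₁₎ (u₍₂₎ \ v) = ε(u) v` -/
  mul_ldiv : ∀ u v, sweedlerComp mul ldiv u v = Coalgebra.counit (R := k) u • v
  /-- `∑ (u v₍₁₎) / v₍₂₎ = ε(v) u` -/
  mul_rdiv : ∀ u v, sweedlerThen mul.flip rdiv.flip v u = Coalgebra.counit (R := k) v • u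
  /-- `∑ (u / v₍₁₎) v₍₂₎ = ε(v) u` -/
  rdiv_mul : ∀ u v, sweedlerThen rdiv.flip mul.flip v u = Coalgebra.counit (R := k) v • u

namespace NonassocHopfAlgebra

variable {k U : Type*} [Field k] [AddCommGroup U] [Module k U] [Coalgebra k U]
  (A : NonassocHopfAlgebra k U)

/-- `r(u,v)(x) = ∑ ((x u₍₁₎) v₍₁₎) / (u₍₂₎ v₍₂₎)`, as a function of `u ⊗ v`. -/
noncomputable def r : U ⊗[k] U →ₗ[k] Module.End k U :=
  sweedlerThen
    (TensorProduct.lift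
      ((LinearMap.mul k (Module.End k U)).flip.compl₁₂ A.mul.flip A.mul.flip))
    (A.rdiv.flip ∘ₗ TensorProduct.lift A.mul)

/-- `H(u,v)(x) = ∑ r(u₍₁₎,v₍₁₎)(x) (u₍₂₎ ∘ v₍₂₎)`, as a function of `u ⊗ v`. -/
noncomputable def hypoH (circ : U ⊗[k] U →ₗ[k] U) : U ⊗[k] U →ₗ[k] Module.End k U :=
  sweedlerThen A.r (A.mul.flip ∘ₗ circ)

/-- `H'(u,v)(y) = ∑ (u₍₁₎ ∘ v₍₁₎) \ H(u₍₂₎,v₍₂₎)(y)`, as a function of `u ⊗ v`. -/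
noncomputable def hypoH' (circ : U ⊗[k] U →ₗ[k] U) : U ⊗[k] U →ₗ[k] Module.End k U :=
  sweedlerComp (A.ldiv ∘ₗ circ) (A.hypoH circ)

/-- Right hypospeciality: for some coalgebra morphism `∘` with `u ∘ 1 = ε(u) 1 = 1 ∘ u`,
`H(u,v)(x y) = ∑ H(u₍₁₎,v₍₁₎)(x) H'(u₍₂₎,v₍₂₎)(y)`. -/
def RightHypospecial : Prop :=
  ∃ circ : U ⊗[k] U →ₗc[k] U,
    (∀ u, circ (u ⊗ₜ[k] A.one) = Coalgebra.counit (R := k) u • A.one) ∧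
    (∀ u, circ (A.one ⊗ₜ[k] u) = Coalgebra.counit (R := k) u • A.one) ∧
    ∀ u v x y, A.hypoH circ.toLinearMap (u ⊗ₜ[k] v) (A.mul x y) =
      sweedler A.mul ((A.hypoH circ.toLinearMap).flip x) ((A.hypoH' circ.toLinearMap).flip y)
        (u ⊗ₜ[k] v)

/-- `iterMul n y x = ∑ (((x y₍₁₎) y₍₂₎) ⋯) y₍ₙ₎`, which is `ε(y) x` for `n = 0`. -/
noncomputable def iterMul : ℕ → U →ₗ[k] Module.End k U
  | 0 => (Coalgebra.counit (R := k) (A := U)).smulRight 1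
  | n + 1 => sweedlerThen (iterMul n) A.mul.flip

/-- Right monoalternativity: `∑ (((x y₍₁₎) y₍₂₎) ⋯) y₍ₙ₎ = ∑ x ((y₍₁₎ y₍₂₎) ⋯ y₍ₙ₎)` for all
`n ≥ 0`. The right-hand product is written as `((1 y₍₁₎) y₍₂₎) ⋯ y₍ₙ₎`. -/
def RightMonoalternative : Prop :=
  ∀ (n : ℕ) (x y : U), A.iterMul n y x = A.mul x (A.iterMul n y A.one)

/-- A non-associative Hopf algebra is hyporeductive if it is right hypospecial and right
monoalternative. -/
def IsHyporeductive : Prop := A.RightHypospecial ∧ A.RightMonoalternative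

end NonassocHopfAlgebra

/-! ### The bialgebra structure of the universal enveloping algebra -/

namespace UniversalEnvelopingAlgebra

variable (k 𝔤 : Type*) [Field k] [LieRing 𝔤] [LieAlgebra k 𝔤]

attribute [local instance 100] LieRing.ofAssociativeRing

theorem algHom_ext_of_ι {A : Type*} [Ring A] [Algebra k A]
    {f g : UniversalEnvelopingAlgebra k 𝔤 →ₐ[k] A} (h : ∀ x, f (ι k x) = g (ι k x)) : f = g :=
  hom_ext k (LieHom.ext h)

/-- The map `x ↦ x ⊗ 1 + 1 ⊗ x`. -/
noncomputable def comulLie :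
    𝔤 →ₗ⁅k⁆ UniversalEnvelopingAlgebra k 𝔤 ⊗[k] UniversalEnvelopingAlgebra k 𝔤 :=
  { (TensorProduct.mk k _ _).flip 1 ∘ₗ (ι k : 𝔤 →ₗ⁅k⁆ _).toLinearMap +
      TensorProduct.mk k _ _ 1 ∘ₗ (ι k : 𝔤 →ₗ⁅k⁆ _).toLinearMap with
    map_lie' := by
      intro x y
      simp [LieRing.of_associative_ring_bracket, TensorProduct.tmul_sub,
        mul_add, add_mul, -ι_apply]
      abel }

theorem comulLie_apply (x : 𝔤) : comulLie k 𝔤 x = ι k x ⊗ₜ[k] 1 + 1 ⊗ₜ[k] ι k x := rfl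

/-- The standard bialgebra structure of `U(𝔤)`, for which the elements of `𝔤` are primitive. -/
noncomputable instance instBialgebra : Bialgebra k (UniversalEnvelopingAlgebra k 𝔤) :=
  .ofAlgHom (lift k (comulLie k 𝔤)) (lift k 0)
    (by
      refine algHom_ext_of_ι k 𝔤 fun x => ?_
      simp only [AlgHom.comp_apply, lift_ι_apply,
        comulLie_apply, map_add, Algebra.TensorProduct.map_tmul, map_one, AlgHom.id_apply,
        TensorProduct.add_tmul, TensorProduct.tmul_add,
        Algebra.TensorProduct.one_def]
      abel)
    (by
      refine algHom_ext_of_ι k 𝔤 fun x => ?_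
      simp [-ι_apply, lift_ι_apply, comulLie_apply])
    (by
      refine algHom_ext_of_ι k 𝔤 fun x => ?_
      simp [-ι_apply, lift_ι_apply, comulLie_apply])

theorem comul_ι (x : 𝔤) : Coalgebra.comul (R := k) (ι k x) = ι k x ⊗ₜ[k] 1 + 1 ⊗ₜ[k] ι k x :=
  lift_ι_apply k (comulLie k 𝔤) x

theorem counit_ι (x : 𝔤) : Coalgebra.counit (R := k) (ι k x) = 0 :=
  lift_ι_apply k (0 : 𝔤 →ₗ⁅k⁆ k) x

end UniversalEnvelopingAlgebra

/-! ### Triples and their formal integration -/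

/-- A triple `(𝔤, 𝔰, 𝔠)`: a subalgebra `𝔰` of the Lie algebra `𝔤` and a complement `𝔠`. -/
structure LieTriple (k 𝔤 : Type*) [Field k] [LieRing 𝔤] [LieAlgebra k 𝔤] where
  s : LieSubalgebra k 𝔤
  c : Submodule k 𝔤
  isCompl : IsCompl s.toSubmodule c

namespace LieTriple

variable {k 𝔤 : Type*} [Field k] [LieRing 𝔤] [LieAlgebra k 𝔤]

/-- `N_𝔤(𝔠) = {x | [x, 𝔠] ⊆ 𝔠}`, for a subspace `𝔠` of `𝔤`. -/
def normalizer (c : Submodule k 𝔤) : LieSubalgebra k 𝔤 where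
  carrier := {x | ∀ y ∈ c, ⁅x, y⁆ ∈ c}
  add_mem' {a b} ha hb y hy := by rw [add_lie]; exact c.add_mem (ha y hy) (hb y hy)
  zero_mem' y _ := by rw [zero_lie]; exact c.zero_mem
  smul_mem' t a ha y hy := by rw [smul_lie]; exact c.smul_mem t (ha y hy)
  lie_mem' {a b} ha hb y hy := by
    rw [lie_lie]; exact c.sub_mem (ha _ (hb y hy)) (hb _ (ha y hy))

variable (τ : LieTriple k 𝔤)

/-- The triple is hyporeductive if `𝔤 = N_𝔤(𝔠) + 𝔠`. -/
def IsHyporeductive : Prop := (normalizer τ.c).toSubmodule ⊔ τ.c = ⊤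

/-- The left ideal `U(𝔤) 𝔰`. -/
noncomputable def leftIdeal : Ideal (UniversalEnvelopingAlgebra k 𝔤) :=
  Ideal.span (UniversalEnvelopingAlgebra.ι k '' (τ.s : Set 𝔤))

/-- The left ideal `U(𝔤) 𝔰` as a subspace. -/
noncomputable def leftIdealSubmodule : Submodule k (UniversalEnvelopingAlgebra k 𝔤) :=
  τ.leftIdeal.restrictScalars k

/-- The underlying space of `U_τ = U(𝔤) / U(𝔤) 𝔰`. -/
abbrev Integral : Type _ := UniversalEnvelopingAlgebra k 𝔤 ⧸ τ.leftIdealSubmodule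

/-- The left action of `U(𝔤)` on `U_τ`. -/
noncomputable def act : UniversalEnvelopingAlgebra k 𝔤 →ₗ[k] Module.End k τ.Integral where
  toFun f := τ.leftIdealSubmodule.mapQ τ.leftIdealSubmodule (LinearMap.mulLeft k f)
    fun _ hx => τ.leftIdeal.mul_mem_left f hx
  map_add' f g := by
    ext x
    exact congrArg τ.leftIdealSubmodule.mkQ (add_mul f g x)
  map_smul' t f := by
    ext x
    exact congrArg τ.leftIdealSubmodule.mkQ (smul_mul_assoc t f x)

theorem act_mk (f u : UniversalEnvelopingAlgebra k 𝔤) :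
    τ.act f (τ.leftIdealSubmodule.mkQ u) = τ.leftIdealSubmodule.mkQ (f * u) := rfl

theorem map_mkQ_mul_eq_zero
    (a b : UniversalEnvelopingAlgebra k 𝔤 ⊗[k] UniversalEnvelopingAlgebra k 𝔤)
    (hb : TensorProduct.map τ.leftIdealSubmodule.mkQ τ.leftIdealSubmodule.mkQ b = 0) :
    TensorProduct.map τ.leftIdealSubmodule.mkQ τ.leftIdealSubmodule.mkQ (a * b) = 0 := by
  induction a using TensorProduct.induction_on with
  | zero => simp
  | add a a' h h' => rw [add_mul, map_add, h, h', add_zero]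
  | tmul f g =>
    have key : ∀ b, TensorProduct.map τ.leftIdealSubmodule.mkQ τ.leftIdealSubmodule.mkQ
        ((f ⊗ₜ[k] g) * b) = TensorProduct.map (τ.act f) (τ.act g)
          (TensorProduct.map τ.leftIdealSubmodule.mkQ τ.leftIdealSubmodule.mkQ b) := by
      intro b
      induction b using TensorProduct.induction_on with
      | zero => simp
      | add a a' h h' => rw [mul_add, map_add, h, h', map_add, map_add]
      | tmul u v =>
        simp only [Algebra.TensorProduct.tmul_mul_tmul, TensorProduct.map_tmul, act_mk]
    rw [key, hb, map_zero]

/-- `U(𝔤) 𝔰` is a coideal, so that `U_τ` is a quotient coalgebra of `U(𝔤)`. -/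
instance isCoideal : τ.leftIdealSubmodule.IsCoideal where
  counit_eq_zero x hx := by
    change x ∈ Ideal.span _ at hx
    induction hx using Submodule.span_induction with
    | mem x h => obtain ⟨d, -, rfl⟩ := h; exact UniversalEnvelopingAlgebra.counit_ι k 𝔤 d
    | zero => simp
    | add x y _ _ hx hy => rw [map_add, hx, hy, add_zero]
    | smul a x _ hx => rw [smul_eq_mul, Bialgebra.counit_mul, hx, mul_zero]
  map_mkQ_comul_eq_zero x hx := by
    change x ∈ Ideal.span _ at hx
    induction hx using Submodule.span_induction with
    | mem x h =>
      obtain ⟨d, hd, rfl⟩ := h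
      have h0 : τ.leftIdealSubmodule.mkQ (UniversalEnvelopingAlgebra.ι k d) = 0 :=
        (Submodule.Quotient.mk_eq_zero _).2 (Ideal.subset_span ⟨d, hd, rfl⟩)
      rw [UniversalEnvelopingAlgebra.comul_ι, map_add, TensorProduct.map_tmul,
        TensorProduct.map_tmul, h0, TensorProduct.zero_tmul, TensorProduct.tmul_zero, add_zero]
    | zero => simp
    | add x y _ _ hx hy => rw [map_add, map_add, hx, hy, add_zero]
    | smul a x _ hx =>
      rw [smul_eq_mul, Bialgebra.comul_mul]
      exact τ.map_mkQ_mul_eq_zero _ _ hx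

/-- The subspace of `U(𝔤)` spanned by the symmetrized products
`∑_{σ ∈ Sₙ} c_{σ(1)} ⋯ c_{σ(n)}` with `n ≥ 0` and `c₁, …, cₙ ∈ 𝔠`. -/
noncomputable def symmetrized : Submodule k (UniversalEnvelopingAlgebra k 𝔤) :=
  Submodule.span k {w | ∃ (n : ℕ) (c : Fin n → τ.c), w = ∑ σ : Equiv.Perm (Fin n),
    (List.ofFn fun i => UniversalEnvelopingAlgebra.ι k (c (σ i) : 𝔤)).prod}

/-- The projection `U(𝔤) → U_τ` restricted to the symmetrized products. In characteristic zero it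
is a linear isomorphism, by the Poincaré–Birkhoff–Witt theorem. -/
noncomputable def symmetrizedToIntegral : τ.symmetrized →ₗ[k] τ.Integral :=
  τ.leftIdealSubmodule.mkQ ∘ₗ τ.symmetrized.subtype

open Classical in
/-- The section `u ↦ ρ_u` of the projection `U(𝔤) → U_τ` with values in the symmetrized
products: it sends the class of `∑_σ c_{σ(1)} ⋯ c_{σ(n)}` to this element. The value `0` in the
second case is never used in characteristic zero. -/
noncomputable def rho : τ.Integral →ₗ[k] UniversalEnvelopingAlgebra k 𝔤 :=
  if h : Function.Bijective τ.symmetrizedToIntegral then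
    τ.symmetrized.subtype ∘ₗ (LinearEquiv.ofBijective τ.symmetrizedToIntegral h).symm.toLinearMap
  else 0

/-- The product of `U_τ`: the class of `u` times the class of `∑_σ c_{σ(1)} ⋯ c_{σ(n)}` is the
class of `∑_σ c_{σ(1)} ⋯ c_{σ(n)} u`; that is, `x v = ρ_v(x)`. -/
noncomputable def mul : τ.Integral →ₗ[k] τ.Integral →ₗ[k] τ.Integral :=
  (τ.act ∘ₗ τ.rho).flip

/-- The unit of `U_τ`, the class of `1`. -/
noncomputable def one : τ.Integral := τ.leftIdealSubmodule.mkQ 1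

end LieTriple

/-! Everything is computed in `U(𝔤)`. The relative Poincaré–Birkhoff–Witt theorem
(`symmetrizedToIntegral_bijective`) identifies `U_τ` with the symmetrized products of elements of
`𝔠`. For surjectivity, letters are reordered and symmetrized modulo lower degree. For injectivity,
`𝔤` is made to act on the free space on multisets of basis vectors of `𝔠`: the empty word is killed
by `𝔰`, and a symmetrized product of `n` basis vectors sends it to `n!` times the corresponding
multiset plus shorter ones.

Hence `x v = ρ_v x` for a section `ρ` of `U(𝔤) → U_τ`. By polarization the symmetrized products are
spanned by the powers `cⁿ`, `c ∈ 𝔠`, so `ρ` and the product are morphisms of coalgebras. Right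
division is `u / v = S(ρ_v) u`. Left division is the convolution inverse of `u ↦ (v ↦ u v)`, a
geometric series that is finite on each class of `cⁿ` (`isUnit_toConv`). Monoalternativity is
checked on the class `y` of `cᵐ`, where both sides are `nᵐ cᵐ x`.

For hypospeciality, put `N = N_𝔤(𝔠)` and choose `𝔠' ⊆ 𝔠` complementary to `N`; let `τ' = (𝔤, N,
𝔠')`, with section `ρ'`. The operator `r(u,v)` is the action of `h = ∑ S(ρ_{u₍₁₎v₍₁₎}) ρ_{v₍₂₎}
ρ_{u₍₂₎}`, and `g = ∑ S(ρ'(h₍₁₎)) h₍₂₎` lies in `U(N)`. Let `u ∘ v` be the class of `S(ρ'(h))`.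
Symmetrized products over `𝔠'` are also symmetrized over `𝔠`, so `ρ_{u∘v} = S(ρ'(h))`, and `H(u,v)`
is the action of `g`. Now `g ρ_y = ∑ Ad(g₍₁₎)(ρ_y) g₍₂₎`, and `Ad(U(N))` preserves symmetrized
products because `[N, 𝔠] ⊆ 𝔠`; so `Ad(g)(ρ_y) = ρ_{y'}` with `y'` its class. Acting on `1`, where
`g` gives `u ∘ v`, this identity yields `y' = H'(u,v)(y)`; acting on `x` it is the hypospecial
identity. -/

theorem Multiset.exists_le_of_ne_zero {C : Type*} [LinearOrder C] {m : Multiset C} (h : m ≠ 0) :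
    ∃ l ∈ m, ∀ a ∈ m, l ≤ a := by
  have hm : m.toFinset.Nonempty := by simpa using h
  exact ⟨m.toFinset.min' hm, by simpa using m.toFinset.min'_mem hm,
    fun a ha => m.toFinset.min'_le a (by simpa using ha)⟩

/-! ### Relative Poincaré–Birkhoff–Witt theorem: the representation on words -/

namespace LieTriple

section RelativePBW

variable {k 𝔤 : Type*} [Field k] [LieRing 𝔤] [LieAlgebra k 𝔤] (τ : LieTriple k 𝔤)
  {C : Type*} (b : Module.Basis C k τ.c)

/-- The coordinates of the component in `𝔠` of an element of `𝔤`. -/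
noncomputable def coord : 𝔤 →ₗ[k] C →₀ k :=
  b.repr.toLinearMap ∘ₗ Submodule.projectionOnto τ.c τ.s.toSubmodule τ.isCompl.symm

theorem coord_of_mem {x : 𝔤} (hx : x ∈ τ.s) : τ.coord b x = 0 := by
  have : Submodule.projectionOnto τ.c τ.s.toSubmodule τ.isCompl.symm x = 0 :=
    (Submodule.projectionOnto_apply_eq_zero_iff _).2 hx
  simp [coord, this]

theorem coord_basis (i : C) : τ.coord b (b i : 𝔤) = Finsupp.single i 1 := by
  simp [coord, Submodule.projectionOnto_apply_left]

theorem generators_induction {P : 𝔤 → Prop} (hs : ∀ x ∈ τ.s, P x) (hb : ∀ i, P (b i : 𝔤))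
    (add : ∀ x y, P x → P y → P (x + y)) (smul : ∀ (t : k) x, P x → P (t • x)) (x : 𝔤) : P x := by
  have hc : ∀ y : τ.c, P (y : 𝔤) := by
    intro y
    have hy : y ∈ Submodule.span k (Set.range b) := b.span_eq ▸ Submodule.mem_top
    induction hy using Submodule.span_induction with
    | mem x h => obtain ⟨i, rfl⟩ := h; exact hb i
    | zero => exact hs 0 τ.s.zero_mem
    | add x y _ _ hx hy => exact add _ _ hx hy
    | smul t x _ hx => exact smul _ _ hx
  have hx : x ∈ τ.s.toSubmodule ⊔ τ.c := τ.isCompl.sup_eq_top ▸ Submodule.mem_top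
  obtain ⟨y, hy, z, hz, rfl⟩ := Submodule.mem_sup.1 hx
  exact add _ _ (hs y hy) (hc ⟨z, hz⟩)

/-- The linear extension of `b i ↦ i ::ₘ m`, which vanishes on `𝔰`. -/
noncomputable def consMap (m : Multiset C) : 𝔤 →ₗ[k] Multiset C →₀ k :=
  Finsupp.lmapDomain k k (fun i => i ::ₘ m) ∘ₗ τ.coord b

theorem consMap_of_mem (m : Multiset C) {x : 𝔤} (hx : x ∈ τ.s) : τ.consMap b m x = 0 := by
  simp [consMap, coord_of_mem τ b hx]

theorem consMap_basis (m : Multiset C) (i : C) :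
    τ.consMap b m (b i : 𝔤) = Finsupp.single (i ::ₘ m) 1 := by
  simp [consMap, coord_basis, Finsupp.mapDomain_single]

/-- The span of the multisets of cardinality at most `d`. -/
def wordsLE (k : Type*) [Field k] (C : Type*) (d : ℕ) : Submodule k (Multiset C →₀ k) :=
  Finsupp.supported k k {m : Multiset C | m.card ≤ d}

theorem wordsLE_mono {d e : ℕ} (h : d ≤ e) : wordsLE k C d ≤ wordsLE k C e :=
  Finsupp.supported_mono fun _ hm => le_trans hm h

theorem single_mem_wordsLE {m : Multiset C} {d : ℕ} (h : m.card ≤ d) :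
    Finsupp.single m (1 : k) ∈ wordsLE k C d :=
  Finsupp.single_mem_supported k 1 h

theorem wordsLE_induction {d : ℕ} {P : (Multiset C →₀ k) → Prop}
    (hm : ∀ m : Multiset C, m.card ≤ d → P (Finsupp.single m 1)) (h0 : P 0)
    (add : ∀ p q, P p → P q → P (p + q)) (smul : ∀ (t : k) p, P p → P (t • p))
    {p : Multiset C →₀ k} (hp : p ∈ wordsLE k C d) : P p := by
  rw [wordsLE, Finsupp.supported_eq_span_single] at hp
  induction hp using Submodule.span_induction with
  | mem x h => obtain ⟨m, h, rfl⟩ := h; exact hm m h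
  | zero => exact h0
  | add x y _ _ hx hy => exact add _ _ hx hy
  | smul t x _ hx => exact smul _ _ hx

theorem consMap_mem (m : Multiset C) (x : 𝔤) : τ.consMap b m x ∈ wordsLE k C (m.card + 1) := by
  induction x using τ.generators_induction b with
  | hs x hx => rw [consMap_of_mem τ b m hx]; exact zero_mem _
  | hb i => rw [consMap_basis]; exact single_mem_wordsLE (by simp)
  | add x y hx hy => rw [map_add]; exact add_mem hx hy
  | smul t x hx => rw [map_smul]; exact Submodule.smul_mem _ _ hx

variable [LinearOrder C]

/-- The projection which kills the basis vectors of `𝔠` smaller than `l`. -/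
noncomputable def upperPart (l : C) : 𝔤 →ₗ[k] 𝔤 :=
  LinearMap.id - Finsupp.linearCombination k (fun i => if i < l then (b i : 𝔤) else 0) ∘ₗ τ.coord b

theorem upperPart_of_mem (l : C) {x : 𝔤} (hx : x ∈ τ.s) : τ.upperPart b l x = x := by
  simp [upperPart, coord_of_mem τ b hx]

theorem upperPart_basis_of_lt {l i : C} (h : i < l) : τ.upperPart b l (b i : 𝔤) = 0 := by
  simp [upperPart, coord_basis, h]

theorem upperPart_basis_of_le {l i : C} (h : l ≤ i) : τ.upperPart b l (b i : 𝔤) = b i := by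
  simp [upperPart, coord_basis, h]

open Classical in
/-- The action of `𝔤` on the basis of `U_τ` formed by the multisets of basis vectors of `𝔠`. -/
noncomputable def wordAct (m : Multiset C) : 𝔤 →ₗ[k] Multiset C →₀ k :=
  if h : m = 0 then τ.consMap b m else
    let l := (Multiset.exists_le_of_ne_zero h).choose
    have _hl : (m.erase l).card < m.card :=
      Multiset.card_erase_lt_of_mem (Multiset.exists_le_of_ne_zero h).choose_spec.1
    -- With `m = b_l · m'`, this is forced by `x · (b_l · m') = b_l · (x · m') + [x, b_l] · m'`, the
    -- leading word of `x · m'` being split off. `upperPart` drops the `b i` with `i < l`, which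
    -- just add a letter. The cardinality test serves termination only: longer words do not occur.
    τ.consMap b m +
      (((Finsupp.lift (𝔤 →ₗ[k] Multiset C →₀ k) k (Multiset C))
          fun m' => if m'.card < m.card then wordAct m' else 0).flip (b l : 𝔤) ∘ₗ
        (wordAct (m.erase l) - τ.consMap b (m.erase l)) +
        wordAct (m.erase l) ∘ₗ (LieModule.toEnd k 𝔤 𝔤 (-(b l : 𝔤)) : 𝔤 →ₗ[k] 𝔤)) ∘ₗ
        τ.upperPart b l
  termination_by m.card


/-- The action of `𝔤` on the space with basis the multisets of basis vectors of `𝔠`. -/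
noncomputable def wordRep : (Multiset C →₀ k) →ₗ[k] 𝔤 →ₗ[k] Multiset C →₀ k :=
  Finsupp.lift (𝔤 →ₗ[k] Multiset C →₀ k) k (Multiset C) (τ.wordAct b)

theorem wordRep_single (m : Multiset C) (x : 𝔤) :
    τ.wordRep b (Finsupp.single m 1) x = τ.wordAct b m x := by
  simp [wordRep]

theorem wordAct_zero : τ.wordAct b 0 = τ.consMap b 0 := by
  rw [wordAct]; simp

/-- `T` is the truncated action in the recursion. Replacing it by `wordRep` needs a degree bound on
the correction term, which is itself proved by induction through this form. -/
theorem wordAct_cons_aux {l : C} {m : Multiset C} (hl : ∀ a ∈ m, l ≤ a) :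
    ∃ T : (Multiset C →₀ k) →ₗ[k] 𝔤 →ₗ[k] Multiset C →₀ k,
      (∀ p ∈ Finsupp.supported k k {m' : Multiset C | m'.card ≤ m.card},
        T p = τ.wordRep b p) ∧
      ∀ x, τ.wordAct b (l ::ₘ m) x = τ.consMap b (l ::ₘ m) x +
        (T (τ.wordAct b m (τ.upperPart b l x) - τ.consMap b m (τ.upperPart b l x)) (b l : 𝔤) +
          τ.wordAct b m ⁅τ.upperPart b l x, (b l : 𝔤)⁆) := by
  classical
  refine ⟨(Finsupp.lift (𝔤 →ₗ[k] Multiset C →₀ k) k (Multiset C))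
          fun m' => if m'.card < (l ::ₘ m).card then τ.wordAct b m' else 0, ?_, ?_⟩
  · intro p hp
    rw [wordRep, Finsupp.lift_apply, Finsupp.lift_apply]
    refine Finsupp.sum_congr fun m' hm' => ?_
    have : m'.card ≤ m.card := hp hm'
    rw [if_pos (by simpa using Nat.lt_succ_of_le this)]
  · intro x
    have h : l ::ₘ m ≠ 0 := Multiset.cons_ne_zero
    have hmin : (Multiset.exists_le_of_ne_zero h).choose = l := by
      obtain ⟨h1, h2⟩ := (Multiset.exists_le_of_ne_zero h).choose_spec
      refine le_antisymm (h2 l (Multiset.mem_cons_self l m)) ?_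
      rcases Multiset.mem_cons.1 h1 with h1 | h1
      · exact h1.ge
      · exact hl _ h1
    rw [wordAct, dif_neg h]
    simp only [hmin, Multiset.erase_cons_head, LinearMap.add_apply, LinearMap.comp_apply,
      LinearMap.flip_apply, LinearMap.sub_apply, LieModule.toEnd_apply_apply, neg_lie, lie_skew]

theorem _root_.Multiset.exists_eq_cons_le {C : Type*} [LinearOrder C] {m : Multiset C}
    (h : m ≠ 0) : ∃ l m', m = l ::ₘ m' ∧ ∀ a ∈ m', l ≤ a := by
  obtain ⟨l, hl, hm⟩ := Multiset.exists_le_of_ne_zero h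
  exact ⟨l, m.erase l, (Multiset.cons_erase hl).symm,
    fun a ha => hm a (Multiset.mem_of_mem_erase ha)⟩

theorem wordRep_mem_of_forall {d : ℕ}
    (h : ∀ m : Multiset C, m.card ≤ d → ∀ x, τ.wordAct b m x ∈ wordsLE k C (m.card + 1))
    {p : Multiset C →₀ k} (hp : p ∈ wordsLE k C d) (x : 𝔤) :
    τ.wordRep b p x ∈ wordsLE k C (d + 1) := by
  refine wordsLE_induction (P := fun p => τ.wordRep b p x ∈ wordsLE k C (d + 1)) ?_ ?_ ?_ ?_ hp
  · intro m hm
    rw [wordRep_single]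
    exact wordsLE_mono (by lia) (h m hm x)
  · simp
  · intro p q hp hq
    rw [map_add]
    exact add_mem hp hq
  · intro t p hp
    rw [map_smul]
    exact Submodule.smul_mem _ _ hp

/-- In the recursion the correction to `x · m'` has degree at most `|m'|`, and applying `b_l` raises
this by at most one, to `|m|`. -/
theorem wordAct_sub_consMap_mem (m : Multiset C) (x : 𝔤) :
    τ.wordAct b m x - τ.consMap b m x ∈ wordsLE k C m.card := by
  induction hn : m.card using Nat.strong_induction_on generalizing m x with
  | _ n ih =>
  have ih' : ∀ m' : Multiset C, m'.card < n → ∀ x,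
      τ.wordAct b m' x ∈ wordsLE k C (m'.card + 1) := by
    intro m' h x
    rw [← sub_add_cancel (τ.wordAct b m' x) (τ.consMap b m' x)]
    exact add_mem (wordsLE_mono (Nat.le_succ _) (ih _ h m' x rfl)) (consMap_mem τ b m' x)
  rcases eq_or_ne m 0 with rfl | hm
  · simp [wordAct_zero]
  · obtain ⟨l, m', rfl, hl⟩ := Multiset.exists_eq_cons_le hm
    obtain ⟨T, hT, h⟩ := wordAct_cons_aux τ b hl
    simp only [Multiset.card_cons] at hn
    have he := ih m'.card (by lia) m' (τ.upperPart b l x) rfl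
    rw [h, hT _ he, add_sub_cancel_left]
    refine add_mem ?_ (wordsLE_mono (by lia) (ih' m' (by lia) _))
    exact wordsLE_mono (by lia)
      (wordRep_mem_of_forall τ b (d := m'.card) (fun m'' h'' x => ih' m'' (by lia) x) he _)

theorem wordAct_cons {l : C} {m : Multiset C} (hl : ∀ a ∈ m, l ≤ a) (x : 𝔤) :
    τ.wordAct b (l ::ₘ m) x = τ.consMap b (l ::ₘ m) x +
      (τ.wordRep b (τ.wordAct b m (τ.upperPart b l x) - τ.consMap b m (τ.upperPart b l x)) (b l) +
        τ.wordAct b m ⁅τ.upperPart b l x, (b l : 𝔤)⁆) := by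
  obtain ⟨T, hT, h⟩ := wordAct_cons_aux τ b hl
  rw [h, hT _ (τ.wordAct_sub_consMap_mem b m _)]

/-- If `i` is below the least letter `l`, `upperPart` kills `b i`; if `i = l`, the correction
vanishes by induction and `[b_l, b_l] = 0`. -/
theorem wordAct_basis_of_le {i : C} {m : Multiset C} (hi : ∀ a ∈ m, i ≤ a) :
    τ.wordAct b m (b i) = Finsupp.single (i ::ₘ m) 1 := by
  induction hn : m.card generalizing m with
  | zero => rw [Multiset.card_eq_zero.1 hn, wordAct_zero, consMap_basis]
  | succ n ih =>
    obtain ⟨l, m, rfl, hl⟩ := Multiset.exists_eq_cons_le (m := m) (by rintro rfl; simp at hn)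
    rw [wordAct_cons τ b hl, consMap_basis]
    rcases (hi l (Multiset.mem_cons_self _ _)).lt_or_eq with h | rfl
    · simp [upperPart_basis_of_lt τ b h]
    · rw [upperPart_basis_of_le τ b le_rfl, ih hl (by simpa using hn), consMap_basis]
      simp

/-- The generators of `𝔤` not smaller than `l`: the elements of `𝔰` and the `b i`, `l ≤ i`. -/
def IsUpper (l : C) (x : 𝔤) : Prop := x ∈ τ.s ∨ ∃ i, l ≤ i ∧ x = b i

variable {τ b}

/-- For such `x` the leading term for `l ::ₘ m` is `b_l` applied to the leading term for `m`, so the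
split in the recursion can be undone. -/
theorem IsUpper.wordAct_cons {l : C} {m : Multiset C} {x : 𝔤} (hx : τ.IsUpper b l x)
    (hl : ∀ a ∈ m, l ≤ a) :
    τ.wordAct b (l ::ₘ m) x =
      τ.wordRep b (τ.wordAct b m x) (b l) + τ.wordAct b m ⁅x, (b l : 𝔤)⁆ := by
  have hc : τ.consMap b (l ::ₘ m) x = τ.wordRep b (τ.consMap b m x) (b l) := by
    rcases hx with hx | ⟨i, hi, rfl⟩
    · simp [consMap_of_mem τ b _ hx]
    · rw [consMap_basis, consMap_basis, wordRep_single, wordAct_basis_of_le, Multiset.cons_swap]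
      intro a ha
      rcases Multiset.mem_cons.1 ha with rfl | ha
      exacts [hi, hl a ha]
  have hu : τ.upperPart b l x = x := by
    rcases hx with hx | ⟨i, hi, rfl⟩
    exacts [upperPart_of_mem τ b l hx, upperPart_basis_of_le τ b hi]
  rw [LieTriple.wordAct_cons τ b hl, hu, hc, map_sub, LinearMap.sub_apply]
  abel

variable (τ b)

/-- The defect of the commutation relation of `x` and `z` in the action `wordRep`. -/
noncomputable def defect (x z : 𝔤) : (Multiset C →₀ k) →ₗ[k] Multiset C →₀ k :=
  (τ.wordRep b).flip x ∘ₗ (τ.wordRep b).flip z - (τ.wordRep b).flip z ∘ₗ (τ.wordRep b).flip x -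
    (τ.wordRep b).flip ⁅x, z⁆

theorem defect_apply (x z : 𝔤) (p : Multiset C →₀ k) : τ.defect b x z p =
    τ.wordRep b (τ.wordRep b p z) x - τ.wordRep b (τ.wordRep b p x) z - τ.wordRep b p ⁅x, z⁆ :=
  rfl

theorem defect_symm (x z : 𝔤) (p : Multiset C →₀ k) : τ.defect b x z p = - τ.defect b z x p := by
  rw [defect_apply, defect_apply, ← lie_skew, map_neg]
  abel

variable {τ b}

theorem IsUpper.defect_eq_zero {l : C} {m : Multiset C} {x : 𝔤} (hx : τ.IsUpper b l x)
    (hl : ∀ a ∈ m, l ≤ a) : τ.defect b x (b l) (Finsupp.single m 1) = 0 := by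
  rw [defect_apply, wordRep_single, wordRep_single, wordAct_basis_of_le τ b hl, wordRep_single,
    hx.wordAct_cons hl, wordRep_single]
  abel

/-- The Jacobi case. Both generators are moved past `b_l`. The relation between `x` and `b_l` on `z
· m` holds on the leading word, which has no letter below `l`, and on the rest by induction on
degree; what remains cancels by the Jacobi identity. -/
theorem IsUpper.defect_cons_eq_zero {l : C} {m : Multiset C} {x z : 𝔤} (hx : τ.IsUpper b l x)
    (hz : τ.IsUpper b l z) (hl : ∀ a ∈ m, l ≤ a)
    (ih : ∀ m' : Multiset C, m'.card ≤ m.card → ∀ x z, τ.defect b x z (Finsupp.single m' 1) = 0) :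
    τ.defect b x z (Finsupp.single (l ::ₘ m) 1) = 0 := by
  have ih' : ∀ p ∈ wordsLE k C m.card, ∀ x z, τ.defect b x z p = 0 := by
    intro p hp x z
    refine wordsLE_induction (P := fun p => τ.defect b x z p = 0) (fun m hm => ih m hm x z)
      (map_zero _) ?_ ?_ hp
    · intro p q hp hq
      rw [map_add, hp, hq, add_zero]
    · intro t p hp
      rw [map_smul, hp, smul_zero]
  have top : ∀ {x z : 𝔤}, τ.IsUpper b l x → τ.IsUpper b l z →
      τ.wordRep b (τ.wordRep b (τ.wordAct b m z) (b l)) x =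
        τ.wordRep b (τ.wordRep b (τ.wordAct b m z) x) (b l) +
          τ.wordRep b (τ.wordAct b m z) ⁅x, (b l : 𝔤)⁆ := by
    intro x z hx hz
    have h0 : τ.defect b x (b l) (τ.consMap b m z) = 0 := by
      rcases hz with hz | ⟨i, hi, rfl⟩
      · simp [consMap_of_mem τ b _ hz]
      · rw [consMap_basis]
        refine hx.defect_eq_zero fun a ha => ?_
        rcases Multiset.mem_cons.1 ha with rfl | ha
        exacts [hi, hl a ha]
    have h1 := ih' _ (τ.wordAct_sub_consMap_mem b m z) x (b l)
    rw [map_sub, h0, sub_zero, defect_apply] at h1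
    rw [sub_sub, sub_eq_zero] at h1
    exact h1
  have rel : ∀ x z, τ.wordRep b (τ.wordAct b m z) x =
      τ.wordRep b (τ.wordAct b m x) z + τ.wordAct b m ⁅x, z⁆ := by
    intro x z
    have := ih m le_rfl x z
    rw [defect_apply, sub_sub, sub_eq_zero] at this
    simpa only [wordRep_single] using this
  have jac : ⁅x, ⁅z, (b l : 𝔤)⁆⁆ = ⁅⁅x, z⁆, (b l : 𝔤)⁆ + ⁅z, ⁅x, (b l : 𝔤)⁆⁆ := by
    rw [lie_lie]; abel
  rw [defect_apply]
  simp only [wordRep_single, hx.wordAct_cons hl, hz.wordAct_cons hl, map_add, LinearMap.add_apply]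
  rw [top hx hz, top hz hx, rel x z, rel x ⁅z, (b l : 𝔤)⁆, rel z ⁅x, (b l : 𝔤)⁆, jac]
  have h2 := rel (b l) ⁅x, z⁆
  rw [wordAct_basis_of_le τ b hl, wordRep_single,
    ← lie_skew (b l : 𝔤) ⁅x, z⁆, map_neg] at h2
  rw [map_add, map_add, LinearMap.add_apply, h2]
  abel

/-- Either one generator is a basis vector not above any letter of `m`, and the relation is built
into the recursion; or `m` is empty and both lie in `𝔰`; or both are upper for the least letter of
`m`, which is the Jacobi case. -/
theorem defect_eq_zero_of_generators {m : Multiset C}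
    (ih : ∀ m' : Multiset C, m'.card < m.card → ∀ x z, τ.defect b x z (Finsupp.single m' 1) = 0)
    {x z : 𝔤} (hx : x ∈ τ.s ∨ ∃ i, x = b i) (hz : z ∈ τ.s ∨ ∃ i, z = b i) :
    τ.defect b x z (Finsupp.single m 1) = 0 := by
  have cons : ∀ l m', m = l ::ₘ m' → (∀ a ∈ m', l ≤ a) → τ.IsUpper b l x → τ.IsUpper b l z →
      τ.defect b x z (Finsupp.single m 1) = 0 := by
    rintro l m' rfl hl hx hz
    exact hx.defect_cons_eq_zero hz hl fun m'' h => ih m'' (by simpa using Nat.lt_succ_of_le h)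
  by_cases hall : (∀ i, x = b i → ∃ a ∈ m, a < i) ∧ (∀ i, z = b i → ∃ a ∈ m, a < i)
  · rcases eq_or_ne m 0 with rfl | hm
    · have hx' : x ∈ τ.s := by
        rcases hx with hx | ⟨i, hi⟩
        · exact hx
        · simpa using hall.1 i hi
      have hz' : z ∈ τ.s := by
        rcases hz with hz | ⟨i, hi⟩
        · exact hz
        · simpa using hall.2 i hi
      rw [defect_apply]
      simp [wordRep_single, wordAct_zero, consMap_of_mem, hx', hz', τ.s.lie_mem hx' hz']
    · obtain ⟨l, m', rfl, hl⟩ := Multiset.exists_eq_cons_le hm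
      have key : ∀ y, (y ∈ τ.s ∨ ∃ i, y = b i) → (∀ i, y = b i → ∃ a ∈ l ::ₘ m', a < i) →
          τ.IsUpper b l y := by
        rintro y (hy | ⟨i, rfl⟩) h
        · exact Or.inl hy
        · obtain ⟨a, ha, hai⟩ := h i rfl
          refine Or.inr ⟨i, ?_, rfl⟩
          rcases Multiset.mem_cons.1 ha with rfl | ha
          exacts [hai.le, (hl a ha).trans hai.le]
      exact cons l m' rfl hl (key x hx hall.1) (key z hz hall.2)
  · rw [not_and_or] at hall
    push Not at hall
    have swap : ∀ {x z : 𝔤}, (x ∈ τ.s ∨ ∃ i, x = b i) → ∀ j, z = b j → (∀ a ∈ m, j ≤ a) →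
        τ.defect b x z (Finsupp.single m 1) = 0 := by
      rintro x z hx j rfl hj
      by_cases hxj : τ.IsUpper b j x
      · exact hxj.defect_eq_zero hj
      -- Here `x = b i` with `i < j`, so `i` is also below every letter of `m`, and antisymmetry
      -- exchanges the two roles.
      · rcases hx with hx | ⟨i, rfl⟩
        · exact absurd (Or.inl hx) hxj
        · have hij : i < j := by
            by_contra h
            exact hxj (Or.inr ⟨i, not_lt.1 h, rfl⟩)
          rw [defect_symm, IsUpper.defect_eq_zero (Or.inr ⟨j, hij.le, rfl⟩)
            fun a ha => hij.le.trans (hj a ha), neg_zero]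
    rcases hall with ⟨i, hi, h⟩ | ⟨i, hi, h⟩
    · rw [defect_symm, swap hz i hi h, neg_zero]
    · exact swap hx i hi h

theorem defect_eq_zero (x z : 𝔤) : τ.defect b x z = 0 := by
  have gen : ∀ m : Multiset C, ∀ x z, τ.defect b x z (Finsupp.single m 1) = 0 := by
    intro m
    induction hn : m.card using Nat.strong_induction_on generalizing m with
    | _ n ih =>
    subst hn
    have step : ∀ x, (x ∈ τ.s ∨ ∃ i, x = b i) → ∀ z, τ.defect b x z (Finsupp.single m 1) = 0 := by
      intro x hx z
      induction z using τ.generators_induction b with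
      | hs z hz => exact defect_eq_zero_of_generators (fun m' h => ih _ h m' rfl) hx (Or.inl hz)
      | hb i => exact defect_eq_zero_of_generators (fun m' h => ih _ h m' rfl) hx (Or.inr ⟨i, rfl⟩)
      | add y z hy hz =>
        have := congrArg₂ (· + ·) hy hz
        simp only [defect_apply, lie_add, map_add, LinearMap.add_apply, add_zero] at this ⊢
        rw [← this]; abel
      | smul t y hy =>
        have := congrArg (t • ·) hy
        simp only [defect_apply, lie_smul, map_smul, LinearMap.smul_apply, smul_zero,
          smul_sub] at this ⊢
        exact this
    intro x z
    induction x using τ.generators_induction b with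
    | hs x hx => exact step x (Or.inl hx) z
    | hb i => exact step _ (Or.inr ⟨i, rfl⟩) z
    | add x y hx hy =>
      have := congrArg₂ (· + ·) hx hy
      simp only [defect_apply, add_lie, map_add, LinearMap.add_apply, add_zero] at this ⊢
      rw [← this]; abel
    | smul t x hx =>
      have := congrArg (t • ·) hx
      simp only [defect_apply, smul_lie, map_smul, LinearMap.smul_apply, smul_zero,
        smul_sub] at this ⊢
      exact this
  refine Finsupp.lhom_ext' fun m => LinearMap.ext_ring ?_
  simpa using gen m x z

variable (τ b)

attribute [local instance 100] LieRing.ofAssociativeRing in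
/-- The representation of `𝔤` on the space with basis the multisets of basis vectors of `𝔠`. -/
noncomputable def wordLieHom : 𝔤 →ₗ⁅k⁆ Module.End k (Multiset C →₀ k) :=
  { (τ.wordRep b).flip with
    map_lie' := by
      intro x z
      refine LinearMap.ext fun p => ?_
      have := congrArg (fun f => f p) (defect_eq_zero (τ := τ) (b := b) x z)
      exact (sub_eq_zero.1 this).symm }

attribute [local instance 100] LieRing.ofAssociativeRing in
/-- The action of `U(𝔤)` on the empty word. -/
noncomputable def wordEval : UniversalEnvelopingAlgebra k 𝔤 →ₗ[k] Multiset C →₀ k :=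
  LinearMap.applyₗ (Finsupp.single (0 : Multiset C) (1 : k)) ∘ₗ
    (UniversalEnvelopingAlgebra.lift k (τ.wordLieHom b)).toLinearMap

theorem wordEval_one : τ.wordEval b 1 = Finsupp.single 0 1 := by
  simp [wordEval]

theorem wordEval_ι_mul (x : 𝔤) (u : UniversalEnvelopingAlgebra k 𝔤) :
    τ.wordEval b (UniversalEnvelopingAlgebra.ι k x * u) = τ.wordRep b (τ.wordEval b u) x := by
  simp only [wordEval, LinearMap.comp_apply, AlgHom.toLinearMap_apply, map_mul,
    UniversalEnvelopingAlgebra.lift_ι_apply]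
  rfl

/-- `𝔰` kills the empty word, hence so does the left ideal it generates; `wordEval` thus factors
through `U_τ`. -/
theorem wordEval_eq_zero {u : UniversalEnvelopingAlgebra k 𝔤} (hu : u ∈ τ.leftIdeal) :
    τ.wordEval b u = 0 := by
  induction hu using Submodule.span_induction with
  | mem x h =>
    obtain ⟨d, hd, rfl⟩ := h
    rw [← mul_one (UniversalEnvelopingAlgebra.ι k d), wordEval_ι_mul, wordEval_one, wordRep_single,
      wordAct_zero, consMap_of_mem τ b _ hd]
  | zero => simp
  | add x y _ _ hx hy => rw [map_add, hx, hy, add_zero]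
  | smul a x _ hx =>
    simp only [wordEval, LinearMap.comp_apply, AlgHom.toLinearMap_apply, smul_eq_mul, map_mul,
      LinearMap.applyₗ_apply_apply, Module.End.mul_apply] at hx ⊢
    rw [hx, map_zero]

theorem wordRep_sub_mem {d : ℕ} (i : C) {p : Multiset C →₀ k} (hp : p ∈ wordsLE k C d) :
    τ.wordRep b p (b i) - Finsupp.lmapDomain k k (fun m => i ::ₘ m) p ∈ wordsLE k C d := by
  refine wordsLE_induction (P := fun p => τ.wordRep b p (b i) -
    Finsupp.lmapDomain k k (fun m => i ::ₘ m) p ∈ wordsLE k C d) ?_ ?_ ?_ ?_ hp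
  · intro m hm
    have := τ.wordAct_sub_consMap_mem b m (b i)
    rw [consMap_basis] at this
    simpa [wordRep_single, Finsupp.mapDomain_single] using wordsLE_mono hm this
  · simp
  · intro p q hp hq
    rw [map_add, map_add, LinearMap.add_apply, add_sub_add_comm]
    exact add_mem hp hq
  · intro t p hp
    rw [map_smul, map_smul, LinearMap.smul_apply, ← smul_sub]
    exact Submodule.smul_mem _ _ hp

/-- Up to terms of smaller degree, the product of basis vectors of `𝔠` sends the empty word to the
corresponding word. -/
theorem wordEval_prod (l : List C) : ∃ p : Multiset C →₀ k,
    τ.wordEval b (l.map fun i => UniversalEnvelopingAlgebra.ι k (b i : 𝔤)).prod =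
      Finsupp.single (l : Multiset C) 1 + p ∧ ∀ m ∈ p.support, m.card < l.length := by
  induction l with
  | nil => exact ⟨0, by simpa using τ.wordEval_one b, by simp⟩
  | cons i l ih =>
    obtain ⟨p, hp, h⟩ := ih
    rw [List.map_cons, List.prod_cons, wordEval_ι_mul, hp]
    refine ⟨_, (add_sub_cancel _ _).symm, fun m hm => ?_⟩
    have h1 : Finsupp.single (l : Multiset C) 1 + p ∈ wordsLE k C l.length :=
      add_mem (single_mem_wordsLE (by simp)) fun m hm => (h m hm).le
    have h2 := τ.wordRep_sub_mem b i h1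
    rw [map_add (Finsupp.lmapDomain k k _), ← sub_sub] at h2
    have h3 : Finsupp.lmapDomain k k (fun m => i ::ₘ m) p ∈ wordsLE k C l.length := by
      classical
      intro m hm
      obtain ⟨m', hm', rfl⟩ := Finset.mem_image.1 (Finsupp.mapDomain_support hm)
      simpa using h m' hm'
    have h4 := add_mem h2 h3
    rw [sub_add_cancel] at h4
    simp only [Finsupp.lmapDomain_apply, Finsupp.mapDomain_single, Multiset.cons_coe] at h4
    exact Nat.lt_succ_of_le (h4 hm)

end RelativePBW
end LieTriple

/-! ### Symmetrized products -/

section Symmetrization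

variable {k A : Type*} [Field k] [Ring A] [Algebra k A] {n : ℕ}

/-- The sum of the products of `f 0, …, f (n - 1)` in all orders. -/
def symSum (f : Fin n → A) : A := ∑ σ : Equiv.Perm (Fin n), (List.ofFn fun i => f (σ i)).prod

theorem symSum_comp_perm (f : Fin n → A) (π : Equiv.Perm (Fin n)) :
    symSum (f ∘ π) = symSum f :=
  Fintype.sum_equiv (Equiv.mulLeft π) _ _ fun _ => rfl

theorem symSum_const (a : A) (n : ℕ) : symSum (fun _ : Fin n => a) = n.factorial • a ^ n := by
  simp [symSum, Fintype.card_perm]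

variable (k A n) in
/-- `symSum` as a multilinear map. -/
noncomputable def symSumMultilinear : MultilinearMap k (fun _ : Fin n => A) A :=
  ∑ σ : Equiv.Perm (Fin n), (MultilinearMap.mkPiAlgebraFin k n A).domDomCongr σ

theorem symSumMultilinear_apply (f : Fin n → A) : symSumMultilinear k A n f = symSum f := by
  simp [symSumMultilinear, symSum]

end Symmetrization

/-! ### Degree filtration of the enveloping algebra -/

namespace UniversalEnvelopingAlgebra

variable {k 𝔤 : Type*} [Field k] [LieRing 𝔤] [LieAlgebra k 𝔤]

attribute [local instance 100] LieRing.ofAssociativeRing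

theorem ι_mul_ι (x y : 𝔤) : ι k x * ι k y = ι k y * ι k x + ι k ⁅x, y⁆ := by
  rw [LieHom.map_lie, LieRing.of_associative_ring_bracket]; abel

theorem mem_of_forall_ι_mem (Q : Subalgebra k (UniversalEnvelopingAlgebra k 𝔤))
    (h : ∀ x, ι k x ∈ Q) (u : UniversalEnvelopingAlgebra k 𝔤) : u ∈ Q := by
  let f : 𝔤 →ₗ⁅k⁆ Q :=
    { LinearMap.codRestrict (Subalgebra.toSubmodule Q) (ι k : 𝔤 →ₗ⁅k⁆ _).toLinearMap h with
      map_lie' := by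
        intro x y
        exact Subtype.ext (LieHom.map_lie (ι k) x y) }
  have hf : Q.val.comp (lift k f) = AlgHom.id k _ := by
    refine algHom_ext_of_ι k 𝔤 fun x => ?_
    rw [AlgHom.comp_apply, lift_ι_apply]
    rfl
  have := congrArg (fun g => g u) hf
  rw [AlgHom.comp_apply, AlgHom.id_apply] at this
  rw [← this]
  exact (lift k f u).2

theorem induction_ι_mul {P : UniversalEnvelopingAlgebra k 𝔤 → Prop} (one : P 1)
    (add : ∀ u v, P u → P v → P (u + v)) (smul : ∀ (t : k) u, P u → P (t • u))
    (ι_mul : ∀ x u, P u → P (ι k x * u)) (u : UniversalEnvelopingAlgebra k 𝔤) : P u := by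
  let Q : Subalgebra k (UniversalEnvelopingAlgebra k 𝔤) :=
    { carrier := {u | ∀ v, P v → P (u * v)}
      mul_mem' := fun {a b} ha hb v hv => by rw [mul_assoc]; exact ha _ (hb v hv)
      add_mem' := fun {a b} ha hb v hv => by rw [add_mul]; exact add _ _ (ha v hv) (hb v hv)
      algebraMap_mem' := fun t v hv => by rw [← Algebra.smul_def]; exact smul t v hv }
  simpa using mem_of_forall_ι_mem Q ι_mul u 1 one

/-- The span of the products of fewer than `n` elements of `𝔤`. -/
def degreeLT (k 𝔤 : Type*) [Field k] [LieRing 𝔤] [LieAlgebra k 𝔤] (n : ℕ) :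
    Submodule k (UniversalEnvelopingAlgebra k 𝔤) :=
  Submodule.span k {u | ∃ l : List 𝔤, l.length < n ∧ u = (l.map (ι k)).prod}

theorem prod_mem_degreeLT {l : List 𝔤} {n : ℕ} (h : l.length < n) :
    (l.map (ι k)).prod ∈ degreeLT k 𝔤 n :=
  Submodule.subset_span ⟨l, h, rfl⟩

theorem ι_mul_mem_degreeLT {n : ℕ} {u : UniversalEnvelopingAlgebra k 𝔤}
    (hu : u ∈ degreeLT k 𝔤 n) (x : 𝔤) : ι k x * u ∈ degreeLT k 𝔤 (n + 1) := by
  induction hu using Submodule.span_induction with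
  | mem u h =>
    obtain ⟨l, hl, rfl⟩ := h
    exact prod_mem_degreeLT (l := x :: l) (by simpa using hl)
  | zero => simp
  | add u v _ _ hu hv => rw [mul_add]; exact add_mem hu hv
  | smul t u _ hu => rw [mul_smul_comm]; exact Submodule.smul_mem _ _ hu

theorem mul_prod_mem_degreeLT {n : ℕ} {u : UniversalEnvelopingAlgebra k 𝔤}
    (hu : u ∈ degreeLT k 𝔤 n) (l : List 𝔤) :
    u * (l.map (ι k)).prod ∈ degreeLT k 𝔤 (n + l.length) := by
  induction hu using Submodule.span_induction with
  | mem u h =>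
    obtain ⟨l', hl, rfl⟩ := h
    rw [← List.prod_append, ← List.map_append]
    exact prod_mem_degreeLT (by simpa using hl)
  | zero => simp
  | add u v _ _ hu hv => rw [add_mul]; exact add_mem hu hv
  | smul t u _ hu => rw [smul_mul_assoc]; exact Submodule.smul_mem _ _ hu

/-- Swapping two adjacent letters costs one bracket, which shortens the product by one. -/
theorem prod_sub_prod_mem_of_perm {l l' : List 𝔤} (h : l.Perm l') :
    (l.map (ι k)).prod - (l'.map (ι k)).prod ∈ degreeLT k 𝔤 l.length := by
  induction h with
  | nil => simp
  | cons x _ ih =>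
    rw [List.map_cons, List.map_cons, List.prod_cons, List.prod_cons, ← mul_sub]
    exact ι_mul_mem_degreeLT ih x
  | swap x y l =>
    simp only [List.map_cons, List.prod_cons, ← mul_assoc, ← sub_mul]
    rw [ι_mul_ι y x, add_sub_cancel_left]
    exact prod_mem_degreeLT (l := ⁅y, x⁆ :: l) (by simp)
  | trans h₁ _ ih₁ ih₂ =>
    rw [← h₁.length_eq] at ih₂
    simpa using add_mem ih₁ ih₂

theorem exists_mem_degreeLT (u : UniversalEnvelopingAlgebra k 𝔤) : ∃ n, u ∈ degreeLT k 𝔤 n := by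
  have mono : ∀ {m n}, m ≤ n → degreeLT k 𝔤 m ≤ degreeLT k 𝔤 n := fun h =>
    Submodule.span_mono fun _ ⟨l, hl, hu⟩ => ⟨l, hl.trans_le h, hu⟩
  induction u using induction_ι_mul with
  | one => exact ⟨1, prod_mem_degreeLT (l := []) (by simp)⟩
  | add u v hu hv =>
    obtain ⟨m, hm⟩ := hu
    obtain ⟨n, hn⟩ := hv
    exact ⟨max m n, add_mem (mono (le_max_left _ _) hm) (mono (le_max_right _ _) hn)⟩
  | smul t u hu =>
    obtain ⟨n, hn⟩ := hu
    exact ⟨n, Submodule.smul_mem _ _ hn⟩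
  | ι_mul x u hu =>
    obtain ⟨n, hn⟩ := hu
    exact ⟨n + 1, ι_mul_mem_degreeLT hn x⟩

theorem factorial_smul_prod_sub_symSum_mem {n : ℕ} (f : Fin n → 𝔤) :
    n.factorial • ((List.ofFn f).map (ι k)).prod - symSum (fun i => ι k (f i)) ∈
      degreeLT k 𝔤 n := by
  have hcard : ∀ u : UniversalEnvelopingAlgebra k 𝔤,
      n.factorial • u = ∑ _σ : Equiv.Perm (Fin n), u := by
    simp [Fintype.card_perm]
  rw [symSum, hcard, ← Finset.sum_sub_distrib]
  refine Submodule.sum_mem _ fun σ _ => ?_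
  have := prod_sub_prod_mem_of_perm (k := k) (Equiv.Perm.ofFn_comp_perm σ f).symm
  rw [List.map_ofFn, List.map_ofFn, List.length_ofFn] at this
  rw [List.map_ofFn]
  exact this

end UniversalEnvelopingAlgebra

/-! ### Relative Poincaré–Birkhoff–Witt theorem: bijectivity -/

namespace LieTriple

open UniversalEnvelopingAlgebra

attribute [local instance 100] LieRing.ofAssociativeRing

variable {k 𝔤 : Type*} [Field k] [LieRing 𝔤] [LieAlgebra k 𝔤] (τ : LieTriple k 𝔤)

theorem symSum_mem_symmetrized {n : ℕ} (c : Fin n → τ.c) :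
    symSum (fun i => ι k (c i : 𝔤)) ∈ τ.symmetrized :=
  Submodule.subset_span ⟨n, c, rfl⟩

/-- The subalgebra of `U(𝔤)` generated by `𝔰`. -/
noncomputable def envelope : Subalgebra k (UniversalEnvelopingAlgebra k 𝔤) :=
  Algebra.adjoin k (ι k '' (τ.s : Set 𝔤))

theorem ι_mem_envelope {x : 𝔤} (hx : x ∈ τ.s) : ι k x ∈ τ.envelope :=
  Algebra.subset_adjoin ⟨x, hx, rfl⟩

theorem ι_mem_leftIdeal {x : 𝔤} (hx : x ∈ τ.s) : ι k x ∈ τ.leftIdeal :=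
  Ideal.subset_span ⟨x, hx, rfl⟩

/-- Elements of `U(𝔰)` act on the class of `1` through the counit. -/
theorem sub_counit_mem_leftIdeal {u : UniversalEnvelopingAlgebra k 𝔤} (hu : u ∈ τ.envelope) :
    u - algebraMap k _ (Coalgebra.counit (R := k) u) ∈ τ.leftIdeal := by
  induction hu using Algebra.adjoin_induction with
  | mem u h =>
    obtain ⟨x, hx, rfl⟩ := h
    rw [counit_ι, map_zero, sub_zero]
    exact τ.ι_mem_leftIdeal hx
  | algebraMap t => simp
  | add u v _ _ hu hv =>
    rw [map_add, map_add, add_sub_add_comm]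
    exact add_mem hu hv
  | mul u v _ _ hu hv =>
    have h : u * v - algebraMap k _ (Coalgebra.counit (R := k) (u * v)) =
        u * (v - algebraMap k _ (Coalgebra.counit (R := k) v)) +
        algebraMap k _ (Coalgebra.counit (R := k) v) *
          (u - algebraMap k _ (Coalgebra.counit (R := k) u)) := by
      rw [Bialgebra.counit_mul, (algebraMap k _).map_mul, mul_sub, mul_sub,
        Algebra.commutes _ u, Algebra.commutes _ (algebraMap k _ _)]
      abel
    rw [h]
    exact add_mem (τ.leftIdeal.mul_mem_left _ hv) (τ.leftIdeal.mul_mem_left _ hu)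

/-- The symmetrization of words in the basis `b` of `𝔠`. -/
noncomputable def symWords {C : Type*} [LinearOrder C] (b : Module.Basis C k τ.c) :
    (Multiset C →₀ k) →ₗ[k] UniversalEnvelopingAlgebra k 𝔤 :=
  Finsupp.linearCombination k fun m =>
    symSum fun j => ι k (b ((m.sort (· ≤ ·)).get j) : 𝔤)

variable {C : Type*} [LinearOrder C] (b : Module.Basis C k τ.c)

theorem symWords_single_ofFn {n : ℕ} (i : Fin n → C) :
    τ.symWords b (Finsupp.single (List.ofFn i : Multiset C) 1) =
      symSum fun j => ι k (b (i j) : 𝔤) := by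
  have hs : (List.ofFn i : Multiset C).sort (· ≤ ·) = List.ofFn (i ∘ Tuple.sort i) := by
    refine List.Perm.eq_of_pairwise' (r := (· ≤ ·)) (Multiset.pairwise_sort _ _) ?_ ?_
    · exact List.pairwise_ofFn.2 fun _ _ h => Tuple.monotone_sort i h.le
    · exact (Multiset.coe_eq_coe.1 (Multiset.sort_eq _ _)).trans
        (Equiv.Perm.ofFn_comp_perm _ i).symm
  have aux : ∀ (l : List C) (m : ℕ) (g : Fin m → C), l = List.ofFn g →
      (symSum fun j => ι k (b (l.get j) : 𝔤)) = symSum fun j => ι k (b (g j) : 𝔤) := by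
    rintro l m g h
    have hm : m = l.length := by simp [h]
    subst hm
    rw [List.ofFn_injective ((List.ofFn_get l).trans h)]
  rw [symWords, Finsupp.linearCombination_single, one_smul, aux _ _ _ hs]
  exact symSum_comp_perm (fun j => ι k (b (i j) : 𝔤)) (Tuple.sort i)

theorem symmetrized_le_range : τ.symmetrized ≤ LinearMap.range (τ.symWords b) := by
  refine Submodule.span_le.2 ?_
  rintro _ ⟨n, c, rfl⟩
  -- Modulo the range, the symmetrization is a multilinear map on `𝔠`, so its vanishing can be
  -- tested on basis vectors.
  have h : ((LinearMap.range (τ.symWords b)).mkQ.compMultilinearMap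
      ((symSumMultilinear k _ n).compLinearMap fun _ =>
        (ι k : 𝔤 →ₗ⁅k⁆ _).toLinearMap ∘ₗ τ.c.subtype)) = 0 := by
    refine Module.Basis.ext_multilinear (fun _ => b) fun i => ?_
    refine (Submodule.Quotient.mk_eq_zero _).2 ?_
    exact ⟨_, (τ.symWords_single_ofFn b i).trans (symSumMultilinear_apply (k := k) _).symm⟩
  have := (Submodule.Quotient.mk_eq_zero _).1 (congrArg (fun f => f c) h)
  rwa [MultilinearMap.compLinearMap_apply, symSumMultilinear_apply] at this

theorem wordEval_symWords_single (m : Multiset C) : ∃ p : Multiset C →₀ k,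
    τ.wordEval b (τ.symWords b (Finsupp.single m 1)) =
      (m.card.factorial : k) • Finsupp.single m 1 + p ∧ ∀ m' ∈ p.support, m'.card < m.card := by
  obtain ⟨n, i, rfl⟩ : ∃ n, ∃ i : Fin n → C, m = List.ofFn i := by
    induction m using Quotient.inductionOn with
    | h l => exact ⟨l.length, l.get, by simp⟩
  rw [symWords_single_ofFn, symSum, map_sum]
  have h : ∀ σ : Equiv.Perm (Fin n), ∃ p : Multiset C →₀ k,
      τ.wordEval b (List.ofFn fun j => ι k (b (i (σ j)) : 𝔤)).prod =
        Finsupp.single (List.ofFn i : Multiset C) 1 + p ∧ p ∈ Finsupp.supported k k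
          {m' : Multiset C | m'.card < n} := by
    intro σ
    obtain ⟨p, hp, h⟩ := τ.wordEval_prod b (List.ofFn (i ∘ σ))
    rw [List.map_ofFn, Multiset.coe_eq_coe.2 (Equiv.Perm.ofFn_comp_perm σ i)] at hp
    exact ⟨p, hp, fun m' hm' => by simpa using h m' hm'⟩
  choose p hp hp' using h
  refine ⟨∑ σ, p σ, ?_, fun m' hm' => ?_⟩
  · simp only [hp, Finset.sum_add_distrib, Finset.sum_const, Finset.card_univ, Fintype.card_perm,
      Fintype.card_fin, Multiset.coe_card, List.length_ofFn, Nat.cast_smul_eq_nsmul]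
  · simpa using Submodule.sum_mem _ (fun σ _ => hp' σ) hm'

section CharZero

variable [CharZero k]

/-- Modulo lower degree, the letters from `𝔠` can be moved to the left and symmetrized;
characteristic zero allows division by the factorial. -/
theorem prod_mem_symmetrized_mul_envelope (l : List 𝔤) (hl : ∀ x ∈ l, x ∈ τ.s ∨ x ∈ τ.c)
    (h : degreeLT k 𝔤 l.length ≤ τ.symmetrized * Subalgebra.toSubmodule τ.envelope) :
    (l.map (ι k)).prod ∈ τ.symmetrized * Subalgebra.toSubmodule τ.envelope := by
  classical
  set M := τ.symmetrized * Subalgebra.toSubmodule τ.envelope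
  let l₁ := l.filter (· ∈ τ.c)
  let l₂ := l.filter (¬ · ∈ τ.c)
  have hperm : (l₁ ++ l₂).Perm l := by
    simpa [l₁, l₂] using List.filter_append_perm (fun x => decide (x ∈ τ.c)) l
  have h₂ : (l₂.map (ι k)).prod ∈ τ.envelope := by
    refine Subalgebra.list_prod_mem _ fun u hu => ?_
    obtain ⟨x, hx, rfl⟩ := List.mem_map.1 hu
    obtain ⟨hx, hx'⟩ := List.mem_filter.1 hx
    exact τ.ι_mem_envelope ((hl x hx).resolve_right (by simpa using hx'))
  have h₁ := factorial_smul_prod_sub_symSum_mem (k := k) l₁.get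
  rw [List.ofFn_get] at h₁
  have h₃ := h (by
    have := mul_prod_mem_degreeLT h₁ l₂
    rwa [← List.length_append, hperm.length_eq] at this)
  have h₄ := h (hperm.length_eq ▸ prod_sub_prod_mem_of_perm (k := k) hperm)
  rw [List.map_append, List.prod_append] at h₄
  have h₅ : (symSum fun i => ι k (l₁.get i)) * (l₂.map (ι k)).prod ∈ M := by
    refine Submodule.mul_mem_mul ?_ h₂
    exact τ.symSum_mem_symmetrized fun i =>
      ⟨l₁.get i, by simpa using (List.mem_filter.1 (l₁.get_mem i)).2⟩
  rw [sub_mul] at h₃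
  have h₆ := add_mem h₃ h₅
  rw [sub_add_cancel, smul_mul_assoc, ← Nat.cast_smul_eq_nsmul k] at h₆
  have h₇ := (Submodule.smul_mem_iff M (by exact_mod_cast l₁.length.factorial_ne_zero)).1 h₆
  simpa using sub_mem h₇ h₄

theorem symmetrized_mul_envelope : τ.symmetrized * Subalgebra.toSubmodule τ.envelope = ⊤ := by
  have main : ∀ n, degreeLT k 𝔤 n ≤ τ.symmetrized * Subalgebra.toSubmodule τ.envelope := by
    intro n
    induction n with
    | zero =>
      refine Submodule.span_le.2 ?_
      rintro _ ⟨l, hl, -⟩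
      exact absurd hl (Nat.not_lt_zero _)
    | succ n ih =>
      -- The letters of `l₁` are already in `𝔰` or `𝔠`; those of `l₂` are split into components one
      -- at a time.
      have key : ∀ l₂ l₁ : List 𝔤, (∀ x ∈ l₁, x ∈ τ.s ∨ x ∈ τ.c) → l₁.length + l₂.length ≤ n →
          ((l₁ ++ l₂).map (ι k)).prod ∈ τ.symmetrized * Subalgebra.toSubmodule τ.envelope := by
        intro l₂
        induction l₂ with
        | nil =>
          intro l₁ h hn
          rw [List.append_nil]
          refine τ.prod_mem_symmetrized_mul_envelope l₁ h (le_trans ?_ ih)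
          exact Submodule.span_mono fun _ ⟨l, hl, hu⟩ => ⟨l, hl.trans_le (by simpa using hn), hu⟩
        | cons x l₂ ih₂ =>
          intro l₁ h hn
          have hx : x ∈ τ.s.toSubmodule ⊔ τ.c := τ.isCompl.sup_eq_top ▸ Submodule.mem_top
          obtain ⟨y, hy, z, hz, rfl⟩ := Submodule.mem_sup.1 hx
          have h₁ := ih₂ (l₁ ++ [y]) (by
            simp only [List.mem_append, List.mem_singleton]
            rintro a (ha | rfl)
            exacts [h a ha, Or.inl hy]) (by simp at hn ⊢; lia)
          have h₂ := ih₂ (l₁ ++ [z]) (by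
            simp only [List.mem_append, List.mem_singleton]
            rintro a (ha | rfl)
            exacts [h a ha, Or.inr hz]) (by simp at hn ⊢; lia)
          have := add_mem h₁ h₂
          simpa [-ι_apply, mul_add, add_mul, mul_assoc] using this
      refine Submodule.span_le.2 ?_
      rintro _ ⟨l, hl, rfl⟩
      exact key l [] (by simp) (by simpa using Nat.lt_succ_iff.1 hl)
  refine eq_top_iff.2 fun u _ => ?_
  obtain ⟨n, hn⟩ := exists_mem_degreeLT u
  exact main n hn

theorem symmetrizedToIntegral_surjective : Function.Surjective τ.symmetrizedToIntegral := by
  rw [← LinearMap.range_eq_top, eq_top_iff]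
  rintro x -
  obtain ⟨u, rfl⟩ := Submodule.mkQ_surjective _ x
  have hu : u ∈ τ.symmetrized * Subalgebra.toSubmodule τ.envelope :=
    τ.symmetrized_mul_envelope ▸ Submodule.mem_top
  induction hu using Submodule.mul_induction_on' with
  -- Modulo `U(𝔤) 𝔰`, the product `a v` equals `ε(v) a`.
  | mem_mul_mem a ha v hv =>
    refine ⟨Coalgebra.counit (R := k) v • ⟨a, ha⟩, ?_⟩
    refine (Submodule.Quotient.eq _).2 ?_
    have := τ.leftIdeal.mul_mem_left a (τ.sub_counit_mem_leftIdeal hv)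
    rw [mul_sub, ← Algebra.commutes, ← Algebra.smul_def] at this
    exact show _ ∈ τ.leftIdeal by simpa using neg_mem this
  | add u _ v _ hu hv => rw [map_add]; exact add_mem hu hv

theorem wordEval_comp_symWords_injective :
    Function.Injective (τ.wordEval b ∘ₗ τ.symWords b) := by
  refine (injective_iff_map_eq_zero _).2 fun p hp => ?_
  by_contra hne
  -- At a longest word `m` of the support, only `m` itself contributes, with the nonzero factor
  -- `m.card!`.
  obtain ⟨m, hm, hmax⟩ := Finset.exists_max_image p.support Multiset.card
    (Finsupp.support_nonempty_iff.2 hne)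
  choose q hq hq' using τ.wordEval_symWords_single b
  have h1 : (τ.wordEval b ∘ₗ τ.symWords b) p =
      p.sum fun m' t => t • ((m'.card.factorial : k) • Finsupp.single m' 1 + q m') := by
    conv_lhs => rw [← Finsupp.sum_single p, Finsupp.sum, map_sum]
    refine Finset.sum_congr rfl fun m' _ => ?_
    simp only [← hq]
    rw [← Finsupp.smul_single_one, map_smul]
    rfl
  rw [hp] at h1
  have h2 := congrArg (fun f => f m) h1
  simp only [Finsupp.sum, Finsupp.coe_zero, Pi.zero_apply, Finsupp.finsetSum_apply] at h2
  rw [Finset.sum_eq_single m] at h2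
  · have hqm : q m m = 0 := by
      by_contra h
      exact lt_irrefl _ (hq' m m (Finsupp.mem_support_iff.2 h))
    simp [hqm, Nat.factorial_ne_zero, Finsupp.mem_support_iff.1 hm] at h2
  · intro m' hm' hne'
    have hqm : q m' m = 0 := by
      by_contra h
      exact absurd (hq' m' m (Finsupp.mem_support_iff.2 h)) (not_lt.2 (hmax m' hm'))
    simp [hqm, hne']
  · intro h
    exact absurd hm h

theorem symmetrizedToIntegral_injective : Function.Injective τ.symmetrizedToIntegral := by
  classical
  let b := Module.Basis.ofVectorSpace k τ.c
  -- Any linear order on the basis serves, even in infinite dimension, since only least letters of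
  -- finite multisets are used.
  let _ : LinearOrder (Module.Basis.ofVectorSpaceIndex k τ.c) :=
    linearOrderOfSTO WellOrderingRel
  refine (injective_iff_map_eq_zero _).2 ?_
  rintro ⟨w, hw⟩ h0
  obtain ⟨p, rfl⟩ := τ.symmetrized_le_range b hw
  have h1 : τ.symWords b p ∈ τ.leftIdeal := (Submodule.Quotient.mk_eq_zero _).1 h0
  have h2 : p = 0 := τ.wordEval_comp_symWords_injective b
    ((τ.wordEval_eq_zero b h1).trans (map_zero _).symm)
  simp [h2]

/-- The relative Poincaré–Birkhoff–Witt theorem. -/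
theorem symmetrizedToIntegral_bijective : Function.Bijective τ.symmetrizedToIntegral :=
  ⟨τ.symmetrizedToIntegral_injective, τ.symmetrizedToIntegral_surjective⟩

theorem rho_mkQ {w : UniversalEnvelopingAlgebra k 𝔤} (hw : w ∈ τ.symmetrized) :
    τ.rho (τ.leftIdealSubmodule.mkQ w) = w := by
  rw [rho, dif_pos τ.symmetrizedToIntegral_bijective]
  have : τ.leftIdealSubmodule.mkQ w =
    LinearEquiv.ofBijective _ τ.symmetrizedToIntegral_bijective ⟨w, hw⟩ := rfl
  rw [this, LinearMap.comp_apply, LinearEquiv.coe_coe, LinearEquiv.symm_apply_apply]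
  rfl

theorem rho_mem (x : τ.Integral) : τ.rho x ∈ τ.symmetrized := by
  obtain ⟨⟨w, hw⟩, rfl⟩ := τ.symmetrizedToIntegral_surjective x
  exact (τ.rho_mkQ hw).symm ▸ hw

theorem mkQ_rho (x : τ.Integral) : τ.leftIdealSubmodule.mkQ (τ.rho x) = x := by
  obtain ⟨⟨w, hw⟩, rfl⟩ := τ.symmetrizedToIntegral_surjective x
  exact congrArg _ (τ.rho_mkQ hw)

end CharZero

end LieTriple

/-! ### Polarization: symmetrized products from powers -/

section Polarization

variable {k A : Type*} [Field k] [Ring A] [Algebra k A] {n : ℕ}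

theorem Finset.sum_neg_one_pow_card_of_subset {α : Type*} [Fintype α] [DecidableEq α]
    (T : Finset α) :
    (∑ S : Finset α, if T ⊆ S then (-1 : ℤ) ^ S.card else 0) =
      if T = Finset.univ then (-1) ^ Fintype.card α else 0 := by
  split_ifs with h
  · subst h
    rw [Finset.sum_eq_single Finset.univ]
    · simp
    · intro S _ hS
      rw [if_neg]
      exact fun h => hS (Finset.univ_subset_iff.1 h)
    · simp
  · obtain ⟨a, ha⟩ : ∃ a, a ∉ T := by
      by_contra! h'
      exact h (Finset.eq_univ_iff_forall.2 h')
    -- For `a ∉ T`, the terms of `S` and `S ∪ {a}` cancel.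
    have hu : (Finset.univ : Finset (Finset α)) = (insert a (Finset.univ.erase a)).powerset := by
      rw [Finset.insert_erase (Finset.mem_univ a), Finset.powerset_univ]
    rw [hu, Finset.sum_powerset_insert (Finset.notMem_erase a _), ← Finset.sum_add_distrib]
    refine Finset.sum_eq_zero fun S hS => ?_
    have haS : a ∉ S := fun h => (Finset.mem_erase.1 (Finset.mem_powerset.1 hS h)).1 rfl
    have hsub : T ⊆ insert a S ↔ T ⊆ S := Finset.subset_insert_iff_of_notMem ha
    simp only [hsub, Finset.card_insert_of_notMem haS]
    split_ifs <;> ring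

/-- The polarization identity. -/
theorem sum_neg_one_pow_card_smul_sum_pow (f : Fin n → A) :
    ∑ S : Finset (Fin n), (-1 : ℤ) ^ S.card • (∑ i ∈ S, f i) ^ n = (-1 : ℤ) ^ n • symSum f := by
  have hpow : ∀ S : Finset (Fin n), (∑ i ∈ S, f i) ^ n =
      ∑ r : Fin n → Fin n, if Finset.univ.image r ⊆ S then (List.ofFn fun i => f (r i)).prod
        else 0 := by
    intro S
    have h := (MultilinearMap.mkPiAlgebraFin ℤ n A).map_sum_finset (fun _ i => f i) (fun _ => S)
    simp only [MultilinearMap.mkPiAlgebraFin_apply, List.ofFn_const, List.prod_replicate] at h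
    rw [h, ← Finset.sum_filter]
    refine Finset.sum_congr ?_ fun _ _ => rfl
    ext r
    simp [Fintype.mem_piFinset, Finset.image_subset_iff]
  -- The alternating sum over `S` keeps only the words `r` that use every index, that is, the
  -- permutations.
  have hsum : ∀ r : Fin n → Fin n,
      (∑ S : Finset (Fin n), if Finset.univ.image r ⊆ S then
        (-1 : ℤ) ^ S.card • (List.ofFn fun i => f (r i)).prod else 0) =
      if Function.Bijective r then (-1 : ℤ) ^ n • (List.ofFn fun i => f (r i)).prod else 0 := by
    intro r
    have h := Finset.sum_neg_one_pow_card_of_subset (Finset.univ.image r)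
    rw [Fintype.card_fin] at h
    have hr : Finset.univ.image r = Finset.univ ↔ Function.Bijective r := by
      rw [← Finite.surjective_iff_bijective]
      simp [Finset.eq_univ_iff_forall, Function.Surjective]
    simp only [← ite_zero_smul, ← Finset.sum_smul, h, hr]
  simp only [hpow, Finset.smul_sum, smul_ite, smul_zero]
  rw [Finset.sum_comm]
  simp only [hsum]
  rw [← Finset.sum_filter, symSum, Finset.smul_sum]
  refine (Finset.sum_bij (fun (σ : Equiv.Perm (Fin n)) _ => (⇑σ : Fin n → Fin n)) ?_ ?_ ?_ ?_).symm
  · intro σ _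
    exact Finset.mem_filter.2 ⟨Finset.mem_univ _, σ.bijective⟩
  · intro σ _ π _ h
    exact DFunLike.coe_injective h
  · intro r hr
    exact ⟨Equiv.ofBijective r (Finset.mem_filter.1 hr).2, Finset.mem_univ _, rfl⟩
  · intro σ _
    rfl

end Polarization

/-! ### Hopf algebra structure and adjoint action of the enveloping algebra -/

namespace UniversalEnvelopingAlgebra

variable {k 𝔤 : Type*} [Field k] [LieRing 𝔤] [LieAlgebra k 𝔤]

attribute [local instance 100] LieRing.ofAssociativeRing

theorem comul_ι_mul (x : 𝔤) (u : UniversalEnvelopingAlgebra k 𝔤) :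
    Coalgebra.comul (R := k) (ι k x * u) =
      (ι k x ⊗ₜ[k] 1 + 1 ⊗ₜ[k] ι k x) * Coalgebra.comul (R := k) u := by
  rw [Bialgebra.comul_mul, comul_ι]

theorem comul_ι_pow (x : 𝔤) (n : ℕ) :
    Coalgebra.comul (R := k) (ι k x ^ n) =
      ∑ ij ∈ Finset.HasAntidiagonal.antidiagonal n,
        n.choose ij.1 • ((ι k x ^ ij.1) ⊗ₜ[k] (ι k x ^ ij.2)) := by
  rw [Bialgebra.comul_pow, comul_ι, Commute.add_pow']
  · simp [-ι_apply, Algebra.TensorProduct.tmul_pow]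
  · simp [-ι_apply, Commute, SemiconjBy]

theorem counit_ι_pow (x : 𝔤) (n : ℕ) :
    Coalgebra.counit (R := k) (ι k x ^ n) = (0 : k) ^ n := by
  rw [Bialgebra.counit_pow, counit_ι]

instance : Coalgebra.IsCocomm k (UniversalEnvelopingAlgebra k 𝔤) where
  comm_comp_comul := by
    refine LinearMap.ext fun u => ?_
    simp only [LinearMap.comp_apply, LinearEquiv.coe_coe]
    induction u using induction_ι_mul with
    | one => simp [Algebra.TensorProduct.one_def]
    | add u v hu hv => simp only [map_add, hu, hv]
    | smul t u hu => simp only [map_smul, hu]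
    | ι_mul x u hu =>
      rw [comul_ι_mul]
      conv_rhs => rw [← hu]
      generalize Coalgebra.comul (R := k) u = t
      induction t with
      | zero => simp
      | add s t hs ht => rw [mul_add, map_add, hs, ht, map_add, mul_add]
      | tmul a b =>
        simp only [add_mul, Algebra.TensorProduct.tmul_mul_tmul, one_mul, map_add,
          TensorProduct.comm_tmul]
        abel

/-- The antipode of `U(𝔤)`, as an algebra morphism to the opposite algebra. -/
noncomputable def antipodeOp :
    UniversalEnvelopingAlgebra k 𝔤 →ₐ[k] (UniversalEnvelopingAlgebra k 𝔤)ᵐᵒᵖ :=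
  lift k
    { (MulOpposite.opLinearEquiv k).toLinearMap ∘ₗ (-(ι k : 𝔤 →ₗ⁅k⁆ _).toLinearMap) with
      map_lie' := by
        intro x y
        simp only [LieRing.of_associative_ring_bracket]
        apply MulOpposite.unop_injective
        simp [-ι_apply, LieRing.of_associative_ring_bracket] }

/-- The antipode of `U(𝔤)`. -/
noncomputable def antipodeLinear :
    UniversalEnvelopingAlgebra k 𝔤 →ₗ[k] UniversalEnvelopingAlgebra k 𝔤 :=
  (MulOpposite.opLinearEquiv k).symm.toLinearMap ∘ₗ antipodeOp.toLinearMap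

theorem antipodeLinear_one : antipodeLinear (1 : UniversalEnvelopingAlgebra k 𝔤) = 1 := by
  simp [antipodeLinear]

theorem antipodeLinear_mul (u v : UniversalEnvelopingAlgebra k 𝔤) :
    antipodeLinear (u * v) = antipodeLinear v * antipodeLinear u := by
  simp [antipodeLinear]

theorem antipodeLinear_ι (x : 𝔤) : antipodeLinear (ι k x) = -ι k x := by
  rw [antipodeLinear, LinearMap.comp_apply, AlgHom.toLinearMap_apply, antipodeOp, lift_ι_apply]
  rfl

noncomputable instance : HopfAlgebra k (UniversalEnvelopingAlgebra k 𝔤) where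
  antipode := antipodeLinear
  mul_antipode_rTensor_comul := by
    refine LinearMap.ext fun u => ?_
    simp only [LinearMap.comp_apply]
    induction u using induction_ι_mul with
    | one => simp [Algebra.TensorProduct.one_def, antipodeLinear_one]
    | add u v hu hv => simp only [map_add, hu, hv]
    | smul t u hu => simp only [map_smul, hu]
    | ι_mul x u hu =>
      rw [comul_ι_mul, Bialgebra.counit_mul, counit_ι, zero_mul, map_zero]
      clear hu
      generalize Coalgebra.comul (R := k) u = t
      induction t with
      | zero => simp
      | add s t hs ht => rw [mul_add, map_add, map_add, hs, ht, add_zero]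
      | tmul a b => simp [-ι_apply, add_mul, antipodeLinear_mul, antipodeLinear_ι, mul_assoc]
  mul_antipode_lTensor_comul := by
    refine LinearMap.ext fun u => ?_
    simp only [LinearMap.comp_apply]
    induction u using induction_ι_mul with
    | one => simp [Algebra.TensorProduct.one_def, antipodeLinear_one]
    | add u v hu hv => simp only [map_add, hu, hv]
    | smul t u hu => simp only [map_smul, hu]
    | ι_mul x u hu =>
      -- A primitive left factor turns `∑ u₍₁₎ S(u₍₂₎)` into its commutator with `x`, which vanishes
      -- as the sum is a scalar by induction.
      have h : LinearMap.mul' k _ (LinearMap.lTensor _ antipodeLinear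
          (Coalgebra.comul (R := k) (ι k x * u))) =
          ι k x * LinearMap.mul' k _ (LinearMap.lTensor _ antipodeLinear
            (Coalgebra.comul (R := k) u)) -
          LinearMap.mul' k _ (LinearMap.lTensor _ antipodeLinear
            (Coalgebra.comul (R := k) u)) * ι k x := by
        rw [comul_ι_mul]
        clear hu
        generalize Coalgebra.comul (R := k) u = t
        induction t with
        | zero => simp
        | add s t hs ht =>
          rw [mul_add, map_add, map_add, hs, ht]
          simp only [map_add, mul_add, add_mul]
          abel
        | tmul a b =>
          simp [-ι_apply, add_mul, antipodeLinear_mul, antipodeLinear_ι, mul_assoc, sub_eq_add_neg]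
      rw [h, hu, Bialgebra.counit_mul, counit_ι, zero_mul, map_zero, Algebra.linearMap_apply,
        Algebra.commutes, sub_self]

theorem antipode_ι (x : 𝔤) : HopfAlgebra.antipode k (ι k x) = -ι k x := antipodeLinear_ι x

theorem antipode_ι_pow (x : 𝔤) (n : ℕ) :
    HopfAlgebra.antipode k (ι k x ^ n) = (-1 : k) ^ n • ι k x ^ n := by
  induction n with
  | zero => simp
  | succ n ih =>
    rw [pow_succ, HopfAlgebra.antipode_mul_antidistrib, ih, antipode_ι, pow_succ (-1 : k),
      mul_smul_comm, neg_mul, ← pow_succ', mul_neg_one, neg_smul, smul_neg, ← pow_succ]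

/-- The antipode of `U(𝔤)` as a coalgebra morphism. -/
noncomputable def antipodeCoalgHom :
    UniversalEnvelopingAlgebra k 𝔤 →ₗc[k] UniversalEnvelopingAlgebra k 𝔤 where
  toLinearMap := HopfAlgebra.antipode k
  counit_comp := HopfAlgebra.counit_comp_antipode
  map_comp_comul := by
    refine LinearMap.ext fun u => ?_
    simp only [LinearMap.comp_apply]
    induction u using induction_ι_mul with
    | one => simp [Algebra.TensorProduct.one_def]
    | add u v hu hv => simp only [map_add, hu, hv]
    | smul t u hu => simp only [map_smul, hu]
    | ι_mul x u hu =>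
      rw [comul_ι_mul, HopfAlgebra.antipode_mul_antidistrib, Bialgebra.comul_mul, ← hu, antipode_ι,
        map_neg, comul_ι]
      clear hu
      generalize Coalgebra.comul (R := k) u = t
      induction t with
      | zero => simp
      | add s t hs ht => rw [mul_add, map_add, hs, ht, map_add, add_mul]
      | tmul a b =>
        simp [-ι_apply, add_mul, mul_add, HopfAlgebra.antipode_mul_antidistrib, antipode_ι,
          TensorProduct.tmul_neg, TensorProduct.neg_tmul, add_comm]

attribute [local instance 100] LieRing.ofAssociativeRing in
/-- The adjoint action of `U(𝔤)` on itself. -/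
noncomputable def adjointAction :
    UniversalEnvelopingAlgebra k 𝔤 →ₐ[k] Module.End k (UniversalEnvelopingAlgebra k 𝔤) :=
  lift k ((LieAlgebra.ad k (UniversalEnvelopingAlgebra k 𝔤)).comp (ι k))

theorem adjointAction_ι (x : 𝔤) (z : UniversalEnvelopingAlgebra k 𝔤) :
    adjointAction (ι k x) z = ι k x * z - z * ι k x := by
  rw [adjointAction, lift_ι_apply]
  rfl

/-- `∑ Ad(u₍₁₎)(z) u₍₂₎ = u z`. -/
theorem adjointAction_mul_comul (u z : UniversalEnvelopingAlgebra k 𝔤) :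
    TensorProduct.lift ((LinearMap.mul k (UniversalEnvelopingAlgebra k 𝔤)) ∘ₗ
      adjointAction.toLinearMap.flip z) (Coalgebra.comul (R := k) u) = u * z := by
  induction u using induction_ι_mul with
  | one => simp [Algebra.TensorProduct.one_def]
  | add u v hu hv => rw [map_add, map_add, hu, hv, add_mul]
  | smul t u hu => rw [map_smul, map_smul, hu, smul_mul_assoc]
  | ι_mul x u hu =>
    rw [mul_assoc, ← hu, comul_ι_mul]
    clear hu
    generalize Coalgebra.comul (R := k) u = t
    induction t with
    | zero => simp
    | add s t hs ht => rw [mul_add, map_add, hs, ht, map_add, mul_add]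
    | tmul a b => simp [-ι_apply, add_mul, adjointAction_ι, mul_assoc]

end UniversalEnvelopingAlgebra

/-! ### Coalgebra structure of `U_τ` and multiplicativity of the product -/

namespace LieTriple

open UniversalEnvelopingAlgebra

attribute [local instance 100] LieRing.ofAssociativeRing

variable {k 𝔤 : Type*} [Field k] [LieRing 𝔤] [LieAlgebra k 𝔤] (τ : LieTriple k 𝔤)

theorem comul_mkQ_pow (x : τ.c) (n : ℕ) :
    Coalgebra.comul (R := k) (τ.leftIdealSubmodule.mkQ (ι k (x : 𝔤) ^ n)) =
      ∑ ij ∈ Finset.HasAntidiagonal.antidiagonal n, n.choose ij.1 •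
        (τ.leftIdealSubmodule.mkQ (ι k (x : 𝔤) ^ ij.1) ⊗ₜ[k]
          τ.leftIdealSubmodule.mkQ (ι k (x : 𝔤) ^ ij.2)) := by
  change TensorProduct.map _ _ (Coalgebra.comul (R := k) (ι k (x : 𝔤) ^ n)) = _
  rw [comul_ι_pow, map_sum]
  simp only [map_nsmul, TensorProduct.map_tmul]

theorem counit_mkQ (u : UniversalEnvelopingAlgebra k 𝔤) :
    Coalgebra.counit (R := k) (τ.leftIdealSubmodule.mkQ u) = Coalgebra.counit (R := k) u := rfl

instance : Coalgebra.IsCocomm k τ.Integral where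
  comm_comp_comul := by
    refine LinearMap.ext fun x => ?_
    obtain ⟨u, rfl⟩ := Submodule.mkQ_surjective _ x
    change TensorProduct.comm _ _ _ (TensorProduct.map _ _ (Coalgebra.comul (R := k) u)) =
      TensorProduct.map _ _ (Coalgebra.comul (R := k) u)
    rw [← TensorProduct.map_comm, Coalgebra.comm_comul]

/-- The action of `U(𝔤)` on `U_τ` as a morphism of algebras. -/
noncomputable def actHom : UniversalEnvelopingAlgebra k 𝔤 →ₐ[k] Module.End k τ.Integral :=
  AlgHom.ofLinearMap τ.act
    (Submodule.linearMap_qext _ (LinearMap.ext fun u => by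
      change τ.leftIdealSubmodule.mkQ (1 * u) = τ.leftIdealSubmodule.mkQ u
      rw [one_mul]))
    (fun f g => Submodule.linearMap_qext _ (LinearMap.ext fun u => by
      change τ.leftIdealSubmodule.mkQ (f * g * u) = τ.leftIdealSubmodule.mkQ (f * (g * u))
      rw [mul_assoc]))

theorem act_one : τ.act 1 = 1 := map_one τ.actHom

theorem act_mul (f g : UniversalEnvelopingAlgebra k 𝔤) : τ.act (f * g) = τ.act f * τ.act g :=
  map_mul τ.actHom f g

theorem mul_apply (u v : τ.Integral) : τ.mul u v = τ.act (τ.rho v) u := rfl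

theorem act_comp_rho : τ.mul.flip = τ.act ∘ₗ τ.rho := rfl

variable [CharZero k]

/-- Polarization gives one inclusion; the other holds because equal entries symmetrize to `n! xⁿ`.
This reduces later linear identities to powers, whose coproduct is binomial. -/
theorem symmetrized_eq_span_pow :
    τ.symmetrized = Submodule.span k {w | ∃ (x : τ.c) (n : ℕ), w = ι k (x : 𝔤) ^ n} := by
  refine le_antisymm (Submodule.span_le.2 ?_) (Submodule.span_le.2 ?_)
  · rintro _ ⟨n, c, rfl⟩
    have h := sum_neg_one_pow_card_smul_sum_pow fun i => ι k (c i : 𝔤)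
    change symSum (fun i => ι k (c i : 𝔤)) ∈ _
    have h2 : symSum (fun i => ι k (c i : 𝔤)) = (-1 : ℤ) ^ n •
        ((-1 : ℤ) ^ n • symSum (fun i => ι k (c i : 𝔤))) := by
      rw [smul_smul, ← mul_pow]; simp
    rw [h2, ← h]
    refine zsmul_mem (Submodule.sum_mem _ fun S _ => zsmul_mem ?_ _) _
    refine Submodule.subset_span ⟨∑ i ∈ S, c i, n, ?_⟩
    rw [AddSubmonoidClass.coe_finsetSum, map_sum]
  · rintro _ ⟨x, n, rfl⟩
    have h := τ.symSum_mem_symmetrized (fun _ : Fin n => x)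
    rw [symSum_const, ← Nat.cast_smul_eq_nsmul k] at h
    exact (Submodule.smul_mem_iff _ (by exact_mod_cast n.factorial_ne_zero)).1 h

theorem ι_pow_mem_symmetrized {x : 𝔤} (hx : x ∈ τ.c) (n : ℕ) : ι k x ^ n ∈ τ.symmetrized := by
  rw [symmetrized_eq_span_pow]
  exact Submodule.subset_span ⟨⟨x, hx⟩, n, rfl⟩

theorem rho_mkQ_pow (x : τ.c) (n : ℕ) :
    τ.rho (τ.leftIdealSubmodule.mkQ (ι k (x : 𝔤) ^ n)) = ι k (x : 𝔤) ^ n :=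
  τ.rho_mkQ (τ.ι_pow_mem_symmetrized x.2 n)

/-- The classes of powers of elements of `𝔠` span `U_τ`. -/
theorem integral_induction {P : τ.Integral → Prop}
    (pow : ∀ (x : τ.c) (n : ℕ), P (τ.leftIdealSubmodule.mkQ (ι k (x : 𝔤) ^ n)))
    (add : ∀ u v, P u → P v → P (u + v)) (smul : ∀ (t : k) u, P u → P (t • u))
    (u : τ.Integral) : P u := by
  have hu := τ.rho_mem u
  rw [symmetrized_eq_span_pow] at hu
  rw [← τ.mkQ_rho u]
  generalize τ.rho u = w at hu ⊢
  induction hu using Submodule.span_induction with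
  | mem w h => obtain ⟨x, n, rfl⟩ := h; exact pow x n
  | zero => simpa using smul 0 _ (pow 0 0)
  | add u v _ _ hu hv => rw [map_add]; exact add _ _ hu hv
  | smul t u _ hu => rw [map_smul]; exact smul _ _ hu

theorem integral_hom_ext {M : Type*} [AddCommGroup M] [Module k M] {f g : τ.Integral →ₗ[k] M}
    (h : ∀ (x : τ.c) (n : ℕ), f (τ.leftIdealSubmodule.mkQ (ι k (x : 𝔤) ^ n)) =
      g (τ.leftIdealSubmodule.mkQ (ι k (x : 𝔤) ^ n))) : f = g := by
  refine LinearMap.ext fun u => ?_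
  induction u using τ.integral_induction with
  | pow x n => exact h x n
  | add u v hu hv => rw [map_add, map_add, hu, hv]
  | smul t u hu => rw [map_smul, map_smul, hu]

/-- The section `ρ` as a morphism of coalgebras. -/
noncomputable def rhoCoalgHom : τ.Integral →ₗc[k] UniversalEnvelopingAlgebra k 𝔤 where
  toLinearMap := τ.rho
  counit_comp := τ.integral_hom_ext fun x n => by
    rw [LinearMap.comp_apply, rho_mkQ_pow]; rfl
  map_comp_comul := τ.integral_hom_ext fun x n => by
    simp only [LinearMap.comp_apply, rho_mkQ_pow, comul_mkQ_pow, comul_ι_pow, map_sum, map_nsmul,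
      TensorProduct.map_tmul]

theorem comul_mul (u v : τ.Integral) : Coalgebra.comul (R := k) (τ.mul u v) =
    TensorProduct.map (TensorProduct.lift τ.mul) (TensorProduct.lift τ.mul)
      (Coalgebra.comul (R := k) (u ⊗ₜ[k] v)) := by
  obtain ⟨f, rfl⟩ := Submodule.mkQ_surjective _ u
  have h : Coalgebra.comul (R := k) (τ.mul (τ.leftIdealSubmodule.mkQ f) v) =
      TensorProduct.map τ.leftIdealSubmodule.mkQ τ.leftIdealSubmodule.mkQ
        (Coalgebra.comul (R := k) (τ.rho v * f)) := rfl
  have hρ : Coalgebra.comul (R := k) (τ.rho v) =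
      TensorProduct.map τ.rho τ.rho (Coalgebra.comul (R := k) v) :=
    (LinearMap.congr_fun τ.rhoCoalgHom.map_comp_comul v).symm
  have h2 : Coalgebra.comul (R := k) (τ.leftIdealSubmodule.mkQ f) = TensorProduct.map
      τ.leftIdealSubmodule.mkQ τ.leftIdealSubmodule.mkQ (Coalgebra.comul (R := k) f) := rfl
  rw [h, Bialgebra.comul_mul, hρ, TensorProduct.comul_tmul, h2]
  clear h h2 hρ
  hopf_tensor_induction Coalgebra.comul (R := k) f with f₁ f₂
  hopf_tensor_induction Coalgebra.comul (R := k) v with v₁ v₂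
  simp only [TensorProduct.map_tmul, Algebra.TensorProduct.tmul_mul_tmul,
    TensorProduct.AlgebraTensorModule.tensorTensorTensorComm_tmul, TensorProduct.lift.tmul]
  rfl

theorem counit_mul (u v : τ.Integral) : Coalgebra.counit (R := k) (τ.mul u v) =
    Coalgebra.counit (R := k) u * Coalgebra.counit (R := k) v := by
  obtain ⟨f, rfl⟩ := Submodule.mkQ_surjective _ u
  have h : Coalgebra.counit (R := k) (τ.mul (τ.leftIdealSubmodule.mkQ f) v) =
      Coalgebra.counit (R := k) (τ.rho v * f) := rfl
  have hρ : Coalgebra.counit (R := k) (τ.rho v) = Coalgebra.counit (R := k) v :=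
    LinearMap.congr_fun τ.rhoCoalgHom.counit_comp v
  rw [h, Bialgebra.counit_mul, hρ, mul_comm, counit_mkQ]

end LieTriple

/-! ### Convolution and the two divisions -/

section Convolution

open WithConv

variable {k C U : Type*} [Field k] [AddCommGroup C] [Module k C] [Coalgebra k C]
  [AddCommGroup U] [Module k U]

theorem sweedlerComp_eq (f g : C →ₗ[k] Module.End k U) :
    sweedlerComp f g = (toConv f * toConv g).ofConv := rfl

/-- Cocommutativity turns application in the opposite order into the convolution product with
exchanged factors. -/
theorem sweedlerThen_eq [Coalgebra.IsCocomm k C] (f g : C →ₗ[k] Module.End k U) :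
    sweedlerThen f g = (toConv g * toConv f).ofConv := by
  refine LinearMap.ext fun c => ?_
  rw [LinearMap.convMul_def, ofConv_toConv]
  simp only [sweedlerThen, sweedler, LinearMap.comp_apply]
  conv_rhs => rw [← Coalgebra.comm_comul k c]
  generalize Coalgebra.comul (R := k) c = t
  induction t with
  | zero => simp
  | add s t hs ht => simp only [map_add, hs, ht]
  | tmul a b => rfl

end Convolution

namespace LieTriple

open UniversalEnvelopingAlgebra WithConv

attribute [local instance 100] LieRing.ofAssociativeRing

variable {k 𝔤 : Type*} [Field k] [LieRing 𝔤] [LieAlgebra k 𝔤] (τ : LieTriple k 𝔤)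

theorem act_comp_convMul {C : Type*} [AddCommGroup C] [Module k C] [Coalgebra k C]
    (f g : C →ₗ[k] UniversalEnvelopingAlgebra k 𝔤) :
    toConv (τ.act ∘ₗ f) * toConv (τ.act ∘ₗ g) =
      toConv (τ.act ∘ₗ (toConv f * toConv g).ofConv) := by
  have := LinearMap.algHom_comp_convMul_distrib τ.actHom (toConv f) (toConv g)
  exact congrArg toConv this.symm

variable {A : Type*} [Ring A] [Algebra k A]

theorem convMul_mkQ_pow (f g : WithConv (τ.Integral →ₗ[k] A)) (x : τ.c) (n : ℕ) :
    (f * g) (τ.leftIdealSubmodule.mkQ (ι k (x : 𝔤) ^ n)) =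
      ∑ ij ∈ Finset.HasAntidiagonal.antidiagonal n, n.choose ij.1 •
        (f (τ.leftIdealSubmodule.mkQ (ι k (x : 𝔤) ^ ij.1)) *
          g (τ.leftIdealSubmodule.mkQ (ι k (x : 𝔤) ^ ij.2))) := by
  rw [LinearMap.convMul_apply, comul_mkQ_pow]
  simp only [map_sum, map_nsmul, TensorProduct.map_tmul, LinearMap.mul'_apply]

/-- When `n` factors `x` are distributed over `m > n` places, some place receives none, and there
`h` is evaluated at `1`. -/
theorem convPow_mkQ_pow_eq_zero {h : WithConv (τ.Integral →ₗ[k] A)} (h1 : h τ.one = 0)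
    (x : τ.c) {m n : ℕ} (hmn : n < m) :
    (h ^ m) (τ.leftIdealSubmodule.mkQ (ι k (x : 𝔤) ^ n)) = 0 := by
  induction m generalizing n with
  | zero => exact absurd hmn (Nat.not_lt_zero _)
  | succ m ih =>
    rw [pow_succ, convMul_mkQ_pow]
    refine Finset.sum_eq_zero fun ij hij => ?_
    rw [Finset.HasAntidiagonal.mem_antidiagonal] at hij
    rcases Nat.eq_zero_or_pos ij.2 with h0 | h0
    · rw [h0, pow_zero]
      change _ • (_ * h τ.one) = 0
      rw [h1, mul_zero, smul_zero]
    · rw [ih (by lia), zero_mul, smul_zero]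

theorem act_comp_convOne {C : Type*} [AddCommGroup C] [Module k C] [Coalgebra k C] (c : C)
    (v : τ.Integral) :
    τ.act ((1 : WithConv (C →ₗ[k] UniversalEnvelopingAlgebra k 𝔤)) c) v =
      Coalgebra.counit (R := k) c • v := by
  rw [LinearMap.convOne_apply, Algebra.algebraMap_eq_smul_one, map_smul, act_one]
  rfl

variable [CharZero k]

theorem finite_support_convPow {h : WithConv (τ.Integral →ₗ[k] A)} (h1 : h τ.one = 0)
    (u : τ.Integral) : (Function.support fun m : ℕ => (h ^ m) u).Finite := by
  induction u using τ.integral_induction with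
  | pow x n =>
    refine (Set.finite_Iic n).subset fun m hm => ?_
    by_contra hmn
    exact hm (τ.convPow_mkQ_pow_eq_zero h1 x (not_le.1 hmn))
  | add u v hu hv =>
    refine (hu.union hv).subset fun m hm => ?_
    by_contra hmn
    simp only [Set.mem_union, Function.mem_support, not_or, not_not] at hmn
    exact hm (by simp only [map_add, hmn.1, hmn.2, add_zero])
  | smul t u hu =>
    refine hu.subset fun m hm hmn => hm ?_
    change (h ^ m) (t • u) = 0
    rw [map_smul, show (h ^ m) u = 0 from hmn, smul_zero]

/-- A linear map on `U_τ` which sends `1` to `1` is invertible for the convolution product. -/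
theorem isUnit_toConv {f : WithConv (τ.Integral →ₗ[k] A)} (h1 : f τ.one = 1) : IsUnit f := by
  set h := 1 - f with hh
  have h0 : h τ.one = 0 := by
    have : (1 : WithConv (τ.Integral →ₗ[k] A)) τ.one = 1 := by
      rw [LinearMap.convOne_apply, one, counit_mkQ, Bialgebra.counit_one, map_one]
    change (1 : WithConv (τ.Integral →ₗ[k] A)) τ.one - f τ.one = 0
    rw [this, h1, sub_self]
  have hf : f = 1 - h := by rw [hh, sub_sub_cancel]
  -- The inverse of `1 - h` is the geometric series in `h`, a finite sum on each element.
  let g : WithConv (τ.Integral →ₗ[k] A) := toConv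
    { toFun := fun u => ∑ᶠ m : ℕ, (h ^ m) u
      map_add' := fun u v => by
        simp only [map_add]
        exact finsum_add_distrib (τ.finite_support_convPow h0 u) (τ.finite_support_convPow h0 v)
      map_smul' := fun t u => by
        simp only [map_smul]
        exact (smul_finsum t _).symm }
  have hg : ∀ (x : τ.c) (n N : ℕ), n < N →
      g (τ.leftIdealSubmodule.mkQ (ι k (x : 𝔤) ^ n)) =
        (∑ m ∈ Finset.range N, h ^ m) (τ.leftIdealSubmodule.mkQ (ι k (x : 𝔤) ^ n)) := by
    intro x n N hN
    have : (∑ m ∈ Finset.range N, h ^ m) (τ.leftIdealSubmodule.mkQ (ι k (x : 𝔤) ^ n)) =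
        ∑ m ∈ Finset.range N, (h ^ m) (τ.leftIdealSubmodule.mkQ (ι k (x : 𝔤) ^ n)) := by
      induction Finset.range N using Finset.induction_on with
      | empty => rfl
      | insert a s ha ih => rw [Finset.sum_insert ha, Finset.sum_insert ha, ← ih]; rfl
    rw [this]
    refine finsum_eq_sum_of_support_subset _ fun m hm => ?_
    by_contra hmn
    exact hm (τ.convPow_mkQ_pow_eq_zero h0 x (by simp at hmn; lia))
  -- On the class of `xⁿ` the remainder `h ^ (n + 1)` of the truncated series vanishes.
  have key : ∀ (x : τ.c) (n : ℕ), (1 - h ^ (n + 1)) (τ.leftIdealSubmodule.mkQ (ι k (x : 𝔤) ^ n)) =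
      (1 : WithConv (τ.Integral →ₗ[k] A)) (τ.leftIdealSubmodule.mkQ (ι k (x : 𝔤) ^ n)) := by
    intro x n
    change (1 : WithConv (τ.Integral →ₗ[k] A)) _ - (h ^ (n + 1)) _ = _
    rw [τ.convPow_mkQ_pow_eq_zero h0 x (Nat.lt_succ_self n), sub_zero]
  have hgf : g * f = 1 := by
    refine ofConv_injective (τ.integral_hom_ext fun x n => ?_)
    change (g * f) _ = (1 : WithConv (τ.Integral →ₗ[k] A)) _
    rw [← key, ← geom_sum_mul_neg h (n + 1), ← hf, convMul_mkQ_pow, convMul_mkQ_pow]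
    refine Finset.sum_congr rfl fun ij hij => ?_
    rw [Finset.HasAntidiagonal.mem_antidiagonal] at hij
    rw [hg x ij.1 (n + 1) (by lia)]
  have hfg : f * g = 1 := by
    refine ofConv_injective (τ.integral_hom_ext fun x n => ?_)
    change (f * g) _ = (1 : WithConv (τ.Integral →ₗ[k] A)) _
    rw [← key, ← mul_neg_geom_sum h (n + 1), ← hf, convMul_mkQ_pow, convMul_mkQ_pow]
    refine Finset.sum_congr rfl fun ij hij => ?_
    rw [Finset.HasAntidiagonal.mem_antidiagonal] at hij
    rw [hg x ij.2 (n + 1) (by lia)]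
  exact ⟨⟨f, g, hfg, hgf⟩, rfl⟩

theorem rho_one : τ.rho τ.one = 1 := by
  have := τ.rho_mkQ_pow 0 0
  rwa [pow_zero] at this

theorem mul_one_apply (u : τ.Integral) : τ.mul u τ.one = u := by
  rw [mul_apply, rho_one, act_one]; rfl

theorem one_mul_apply (u : τ.Integral) : τ.mul τ.one u = u := by
  rw [mul_apply, one, act_mk, mul_one, mkQ_rho]

theorem isUnit_mul : IsUnit (toConv τ.mul) :=
  τ.isUnit_toConv (LinearMap.ext τ.one_mul_apply)

/-- The left division of `U_τ`. -/
noncomputable def ldiv : τ.Integral →ₗ[k] τ.Integral →ₗ[k] τ.Integral :=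
  (τ.isUnit_mul.unit⁻¹ : (WithConv (τ.Integral →ₗ[k] Module.End k τ.Integral))ˣ).val.ofConv

theorem ldiv_convMul_mul : toConv τ.ldiv * toConv τ.mul = 1 :=
  τ.isUnit_mul.val_inv_mul

theorem mul_convMul_ldiv : toConv τ.mul * toConv τ.ldiv = 1 :=
  τ.isUnit_mul.mul_val_inv

theorem antipode_rho_convMul_rho :
    toConv (HopfAlgebra.antipode k ∘ₗ τ.rho) * toConv τ.rho = 1 := by
  have := LinearMap.convMul_comp_coalgHom_distrib (toConv (HopfAlgebra.antipode k))
    (toConv LinearMap.id) τ.rhoCoalgHom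
  rw [LinearMap.antipode_mul_id] at this
  refine Eq.trans (congrArg toConv this.symm) ?_
  exact congrArg (fun f => toConv (Algebra.linearMap k _ ∘ₗ f)) τ.rhoCoalgHom.counit_comp

theorem rho_convMul_antipode_rho :
    toConv τ.rho * toConv (HopfAlgebra.antipode k ∘ₗ τ.rho) = 1 := by
  have := LinearMap.convMul_comp_coalgHom_distrib (toConv LinearMap.id)
    (toConv (HopfAlgebra.antipode k)) τ.rhoCoalgHom
  rw [LinearMap.id_mul_antipode] at this
  refine Eq.trans (congrArg toConv this.symm) ?_
  exact congrArg (fun f => toConv (Algebra.linearMap k _ ∘ₗ f)) τ.rhoCoalgHom.counit_comp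

/-- The non-associative Hopf algebra `U_τ`. -/
noncomputable def hopf : NonassocHopfAlgebra k τ.Integral where
  mul := τ.mul
  one := τ.one
  ldiv := τ.ldiv
  -- Right multiplication by `v` is the action of `ρ_v`, and `S ∘ ρ` is the convolution inverse of
  -- `ρ`.
  rdiv := (τ.act ∘ₗ HopfAlgebra.antipode k ∘ₗ τ.rho).flip
  cocomm := inferInstance
  one_mul := τ.one_mul_apply
  mul_one := τ.mul_one_apply
  counit_one := by rw [one, counit_mkQ, Bialgebra.counit_one]
  comul_one := by simpa [one] using τ.comul_mkQ_pow 0 0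
  counit_mul := τ.counit_mul
  comul_mul := τ.comul_mul
  ldiv_mul u v := by
    rw [sweedlerComp_eq, ldiv_convMul_mul]; rfl
  mul_ldiv u v := by
    rw [sweedlerComp_eq, mul_convMul_ldiv]; rfl
  mul_rdiv u v := by
    rw [sweedlerThen_eq, LinearMap.flip_flip, act_comp_rho, act_comp_convMul,
      antipode_rho_convMul_rho]
    exact τ.act_comp_convOne v u
  rdiv_mul u v := by
    rw [sweedlerThen_eq, LinearMap.flip_flip, act_comp_rho, act_comp_convMul,
      rho_convMul_antipode_rho]
    exact τ.act_comp_convOne v u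

theorem hopf_mul : τ.hopf.mul = τ.mul := rfl

theorem hopf_one : τ.hopf.one = τ.one := rfl

/-- Powers of one `x` multiply freely, so only the sum of the multinomial coefficients remains,
which is `nᵐ`; the case `n = 0` uses `0 ^ 0 = 1`. -/
theorem hopf_iterMul_mkQ_pow (x : τ.c) (m n : ℕ) :
    τ.hopf.iterMul n (τ.leftIdealSubmodule.mkQ (ι k (x : 𝔤) ^ m)) =
      (n : k) ^ m • τ.act (ι k (x : 𝔤) ^ m) := by
  induction n generalizing m with
  | zero =>
    rw [NonassocHopfAlgebra.iterMul, LinearMap.smulRight_apply, counit_mkQ, counit_ι_pow]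
    rcases m.eq_zero_or_pos with rfl | hm
    · simp [act_one]
    · simp [hm.ne']
  | succ n ih =>
    rw [NonassocHopfAlgebra.iterMul, sweedlerThen_eq]
    refine (τ.convMul_mkQ_pow (toConv τ.hopf.mul.flip) (toConv (τ.hopf.iterMul n)) x m).trans ?_
    have h : ∀ ij ∈ Finset.HasAntidiagonal.antidiagonal m, m.choose ij.1 •
        ((toConv τ.hopf.mul.flip) (τ.leftIdealSubmodule.mkQ (ι k (x : 𝔤) ^ ij.1)) *
          (toConv (τ.hopf.iterMul n)) (τ.leftIdealSubmodule.mkQ (ι k (x : 𝔤) ^ ij.2))) =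
        (m.choose ij.1 • ((1 : k) ^ ij.1 * (n : k) ^ ij.2)) • τ.act (ι k (x : 𝔤) ^ m) := by
      intro ij hij
      have h1 : (toConv τ.hopf.mul.flip) (τ.leftIdealSubmodule.mkQ (ι k (x : 𝔤) ^ ij.1)) =
          τ.act (ι k (x : 𝔤) ^ ij.1) :=
        congrArg τ.act (τ.rho_mkQ_pow x ij.1)
      rw [h1]
      change _ • (_ * τ.hopf.iterMul n _) = _
      rw [ih, mul_smul_comm, ← act_mul, ← pow_add, Finset.HasAntidiagonal.mem_antidiagonal.1 hij,
        one_pow, one_mul,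
        smul_assoc]
    rw [Finset.sum_congr rfl h, ← Finset.sum_smul, ← (Commute.all (1 : k) (n : k)).add_pow']
    push_cast
    rw [add_comm]

theorem hopf_rightMonoalternative : (τ.hopf.RightMonoalternative) := by
  intro n x y
  induction y using τ.integral_induction with
  | pow c m =>
    have h : τ.hopf.iterMul n (τ.leftIdealSubmodule.mkQ (ι k (c : 𝔤) ^ m)) τ.hopf.one =
        (n : k) ^ m • τ.leftIdealSubmodule.mkQ (ι k (c : 𝔤) ^ m) := by
      rw [hopf_iterMul_mkQ_pow, LinearMap.smul_apply, hopf_one, one, act_mk, mul_one]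
    rw [h, hopf_iterMul_mkQ_pow, map_smul, LinearMap.smul_apply, hopf_mul, mul_apply, rho_mkQ_pow]
  | add u v hu hv => simp only [map_add, LinearMap.add_apply, hu, hv]
  | smul t u hu => simp only [map_smul, LinearMap.smul_apply, hu]

end LieTriple

/-! ### Derivations and symmetrized products -/

section Leibniz

theorem map_prod_ofFn_of_leibniz {A : Type*} [Ring A] (D : A →+ A)
    (hD : ∀ a b, D (a * b) = D a * b + a * D b) {n : ℕ} (f : Fin n → A) :
    D (List.ofFn f).prod = ∑ j, (List.ofFn (Function.update f j (D (f j)))).prod := by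
  induction n with
  | zero => simpa using hD 1 1
  | succ n ih =>
    rw [List.ofFn_succ, List.prod_cons, hD, ih, Fin.sum_univ_succ, Finset.mul_sum]
    congr 1
    · simp [List.ofFn_succ]
    · refine Finset.sum_congr rfl fun j _ => ?_
      rw [List.ofFn_succ, List.prod_cons, Function.update_of_ne (Fin.succ_ne_zero j).symm]
      congr 3
      exact (Function.update_comp_eq_of_injective f (Fin.succ_injective n) j _).symm

theorem map_symSum_of_leibniz {A : Type*} [Ring A] (D : A →+ A)
    (hD : ∀ a b, D (a * b) = D a * b + a * D b) {n : ℕ} (f : Fin n → A) :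
    D (symSum f) = ∑ j, symSum (Function.update f j (D (f j))) := by
  simp only [symSum, map_sum]
  rw [Finset.sum_comm]
  refine Finset.sum_congr rfl fun σ _ => ?_
  rw [map_prod_ofFn_of_leibniz D hD]
  refine Fintype.sum_equiv σ _ _ fun j => ?_
  congr 2
  exact (Function.update_comp_eq_of_injective f σ.injective j _).symm

end Leibniz

/-! ### Convolution of coalgebra morphisms -/

section CoalgHom

open WithConv

variable {k C B : Type*} [Field k] [AddCommGroup C] [Module k C] [Coalgebra k C]
  [Coalgebra.IsCocomm k C] [Ring B] [Bialgebra k B]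

/-- The convolution product of two morphisms from a cocommutative coalgebra to a bialgebra. -/
noncomputable def convCoalgHom (f g : C →ₗc[k] B) : C →ₗc[k] B :=
  (Bialgebra.mulCoalgHom k B).comp
    ((Coalgebra.TensorProduct.map f g).comp (Coalgebra.comulCoalgHom k C))

theorem toLinearMap_convCoalgHom (f g : C →ₗc[k] B) :
    (convCoalgHom f g).toLinearMap =
      (toConv f.toLinearMap * toConv g.toLinearMap).ofConv := rfl

theorem convCoalgHom_apply (f g : C →ₗc[k] B) (c : C) :
    convCoalgHom f g c =
      LinearMap.mul' k B (TensorProduct.map f.toLinearMap g.toLinearMap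
        (Coalgebra.comul (R := k) c)) := rfl

end CoalgHom

/-! ### Right hypospeciality -/

namespace LieTriple

open UniversalEnvelopingAlgebra WithConv

attribute [local instance 100] LieRing.ofAssociativeRing

variable {k 𝔤 : Type*} [Field k] [LieRing 𝔤] [LieAlgebra k 𝔤]
  (τ τ' : LieTriple k 𝔤)

/-- `ad x` is a derivation, so it replaces the entries `c j` one at a time by `[x, c j]`, which
stays in `𝔠`. -/
theorem adjointAction_ι_mem_symmetrized {x : 𝔤} (hx : x ∈ normalizer τ.c)
    {w : UniversalEnvelopingAlgebra k 𝔤} (hw : w ∈ τ.symmetrized) :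
    adjointAction (ι k x) w ∈ τ.symmetrized := by
  induction hw using Submodule.span_induction with
  | mem w h =>
    obtain ⟨n, c, rfl⟩ := h
    have h := map_symSum_of_leibniz
      (adjointAction (ι k x) : Module.End k (UniversalEnvelopingAlgebra k 𝔤)).toAddMonoidHom
      (fun a b => by
        change adjointAction (ι k x) (a * b) = adjointAction (ι k x) a * b +
          a * adjointAction (ι k x) b
        simp only [adjointAction_ι, sub_mul, mul_sub, mul_assoc]
        abel) (fun i => ι k (c i : 𝔤))
    refine (congrArg (· ∈ τ.symmetrized) h).mpr (Submodule.sum_mem _ fun j _ => ?_)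
    have h2 : Function.update (fun i => ι k (c i : 𝔤)) j (adjointAction (ι k x) (ι k (c j : 𝔤))) =
        fun i => ι k ((Function.update c j ⟨⁅x, (c j : 𝔤)⁆, hx _ (c j).2⟩ i : τ.c) : 𝔤) := by
      funext i
      rcases eq_or_ne i j with rfl | hij
      · rw [Function.update_self, Function.update_self, adjointAction_ι, LieHom.map_lie,
          LieRing.of_associative_ring_bracket]
      · rw [Function.update_of_ne hij, Function.update_of_ne hij]
    exact (congrArg (fun f => symSum f ∈ τ.symmetrized) h2).mpr (τ.symSum_mem_symmetrized _)
  | zero => rw [map_zero]; exact zero_mem _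
  | add u v _ _ hu hv => rw [map_add]; exact add_mem hu hv
  | smul t u _ hu => rw [map_smul]; exact Submodule.smul_mem _ _ hu

variable {τ τ'} in
theorem adjointAction_mem_symmetrized (hs : τ'.s ≤ normalizer τ.c)
    {u w : UniversalEnvelopingAlgebra k 𝔤} (hu : u ∈ τ'.envelope) (hw : w ∈ τ.symmetrized) :
    adjointAction u w ∈ τ.symmetrized := by
  induction hu using Algebra.adjoin_induction generalizing w with
  | mem u h => obtain ⟨x, hx, rfl⟩ := h; exact τ.adjointAction_ι_mem_symmetrized (hs hx) hw
  | algebraMap t =>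
    rw [AlgHom.commutes, Module.algebraMap_end_apply]
    exact Submodule.smul_mem _ _ hw
  | add u v _ _ hu hv => rw [map_add]; exact add_mem (hu hw) (hv hw)
  | mul u v _ _ hu hv => rw [map_mul]; exact hu (hv hw)

variable {τ τ'} in
theorem symmetrized_mono (h : τ'.c ≤ τ.c) : τ'.symmetrized ≤ τ.symmetrized := by
  refine Submodule.span_le.2 ?_
  rintro _ ⟨n, c, rfl⟩
  exact τ.symSum_mem_symmetrized fun i => ⟨c i, h (c i).2⟩

variable {τ} in
/-- For a hyporeductive triple, the normalizer of `𝔠` has a complement contained in `𝔠`. -/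
theorem IsHyporeductive.exists_triple (hτ : τ.IsHyporeductive) :
    ∃ τ' : LieTriple k 𝔤, τ'.s = normalizer τ.c ∧ τ'.c ≤ τ.c := by
  -- The part of `𝔠` outside the normalizer: a complement of `N_𝔤(𝔠) ∩ 𝔠` inside `𝔠`.
  obtain ⟨q, hq⟩ := Submodule.exists_isCompl
    ((normalizer τ.c).toSubmodule.comap τ.c.subtype)
  refine ⟨⟨normalizer τ.c, q.map τ.c.subtype, ?_, ?_⟩, rfl, Submodule.map_subtype_le _ _⟩
  · rw [Submodule.disjoint_def]
    rintro _ hx ⟨y, hy, rfl⟩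
    rw [Submodule.disjoint_def.1 hq.disjoint y hx hy, map_zero]
  · rw [codisjoint_iff, ← hτ]
    refine le_antisymm (sup_le_sup_left (Submodule.map_subtype_le _ _) _)
      (sup_le le_sup_left fun x hx => ?_)
    have hx' : (⟨x, hx⟩ : τ.c) ∈ (normalizer τ.c).toSubmodule.comap τ.c.subtype ⊔ q :=
      hq.sup_eq_top ▸ Submodule.mem_top
    obtain ⟨y, hy, z, hz, hyz⟩ := Submodule.mem_sup.1 hx'
    exact Submodule.mem_sup.2 ⟨y, hy, z, ⟨z, hz, rfl⟩, congrArg Subtype.val hyz⟩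

variable [CharZero k]

/-- The morphism of coalgebras `u ↦ S(ρ(ū))` from `U(𝔤)` to itself. -/
noncomputable def antipodeProj :
    UniversalEnvelopingAlgebra k 𝔤 →ₗc[k] UniversalEnvelopingAlgebra k 𝔤 :=
  antipodeCoalgHom.comp (τ.rhoCoalgHom.comp
    (Coalgebra.Quotient.mkQCoalgHom τ.leftIdealSubmodule))

theorem antipodeProj_apply (u : UniversalEnvelopingAlgebra k 𝔤) :
    τ.antipodeProj u = HopfAlgebra.antipode k (τ.rho (τ.leftIdealSubmodule.mkQ u)) := rfl

/-- The factor in `U(𝔰)` of an element of `U(𝔤)`: the map `u ↦ ∑ S(ρ(ū₍₁₎)) u₍₂₎`. -/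
noncomputable def envelopeProj :
    UniversalEnvelopingAlgebra k 𝔤 →ₗc[k] UniversalEnvelopingAlgebra k 𝔤 :=
  convCoalgHom τ.antipodeProj (CoalgHom.id k _)

/-- Of the two terms of `Δ(u x)`, the one with `x` on the left is killed, because the class of `a x`
in `U_τ` is zero. -/
theorem envelopeProj_mul_ι {x : 𝔤} (hx : x ∈ τ.s) (u : UniversalEnvelopingAlgebra k 𝔤) :
    τ.envelopeProj (u * ι k x) = τ.envelopeProj u * ι k x := by
  have h0 : ∀ a, τ.antipodeProj.toLinearMap (a * ι k x) = 0 := by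
    intro a
    have : τ.leftIdealSubmodule.mkQ (a * ι k x) = 0 :=
      (Submodule.Quotient.mk_eq_zero _).2 (τ.leftIdeal.mul_mem_left a (τ.ι_mem_leftIdeal hx))
    change τ.antipodeProj _ = 0
    rw [antipodeProj_apply, this, map_zero, map_zero]
  rw [envelopeProj, convCoalgHom_apply, convCoalgHom_apply, Bialgebra.comul_mul, comul_ι]
  generalize Coalgebra.comul (R := k) u = t
  induction t with
  | zero => simp
  | add s t hs ht => rw [add_mul, map_add, map_add, hs, ht, map_add, map_add, add_mul]
  | tmul a b =>
    simp only [mul_add, Algebra.TensorProduct.tmul_mul_tmul, mul_one, map_add,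
      TensorProduct.map_tmul, LinearMap.mul'_apply, h0, zero_mul, zero_add, mul_assoc]
    rfl

theorem envelopeProj_mul {v : UniversalEnvelopingAlgebra k 𝔤} (hv : v ∈ τ.envelope)
    (u : UniversalEnvelopingAlgebra k 𝔤) : τ.envelopeProj (u * v) = τ.envelopeProj u * v := by
  induction hv using Algebra.adjoin_induction generalizing u with
  | mem v h => obtain ⟨x, hx, rfl⟩ := h; exact τ.envelopeProj_mul_ι hx u
  | algebraMap t =>
    rw [← Algebra.commutes, ← Algebra.commutes, ← Algebra.smul_def, ← Algebra.smul_def, map_smul]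
  | add v w _ _ hv hw => rw [mul_add, map_add, hv, hw, mul_add]
  | mul v w _ _ hv hw => rw [← mul_assoc, hw, hv, mul_assoc]

/-- On powers `ρ` undoes the projection, so the formula becomes the antipode identity `∑ S(w₍₁₎)
w₍₂₎ = ε(w)`. -/
theorem envelopeProj_of_mem_symmetrized {w : UniversalEnvelopingAlgebra k 𝔤}
    (hw : w ∈ τ.symmetrized) :
    τ.envelopeProj w = algebraMap k _ (Coalgebra.counit (R := k) w) := by
  rw [symmetrized_eq_span_pow] at hw
  induction hw using Submodule.span_induction with
  | mem w h =>
    obtain ⟨x, n, rfl⟩ := h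
    rw [← HopfAlgebra.mul_antipode_rTensor_comul_apply, envelopeProj, convCoalgHom_apply,
      comul_ι_pow, map_sum, map_sum]
    rw [map_sum, map_sum]
    refine Finset.sum_congr rfl fun ij _ => ?_
    rw [map_nsmul, map_nsmul, map_nsmul, map_nsmul, TensorProduct.map_tmul, LinearMap.rTensor_tmul]
    have h : τ.antipodeProj.toLinearMap (UniversalEnvelopingAlgebra.ι k (x : 𝔤) ^ ij.1) =
        HopfAlgebra.antipode k (UniversalEnvelopingAlgebra.ι k (x : 𝔤) ^ ij.1) :=
      (τ.antipodeProj_apply _).trans (by rw [τ.rho_mkQ_pow x ij.1])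
    rw [h]
    rfl
  | zero => simp
  | add u v _ _ hu hv => rw [map_add, map_add, hu, hv, map_add]
  | smul t u _ hu => rw [map_smul, map_smul, hu, smul_eq_mul, map_mul, Algebra.smul_def]

theorem envelopeProj_mem (u : UniversalEnvelopingAlgebra k 𝔤) :
    τ.envelopeProj u ∈ τ.envelope := by
  have hu : u ∈ τ.symmetrized * Subalgebra.toSubmodule τ.envelope :=
    τ.symmetrized_mul_envelope ▸ Submodule.mem_top
  induction hu using Submodule.mul_induction_on' with
  | mem_mul_mem a ha v hv =>
    rw [τ.envelopeProj_mul hv, τ.envelopeProj_of_mem_symmetrized ha]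
    exact mul_mem (Subalgebra.algebraMap_mem _ _) hv
  | add u _ v _ hu hv => rw [map_add]; exact add_mem hu hv

theorem antipode_mem_symmetrized {w : UniversalEnvelopingAlgebra k 𝔤} (hw : w ∈ τ.symmetrized) :
    HopfAlgebra.antipode k w ∈ τ.symmetrized := by
  rw [symmetrized_eq_span_pow] at hw
  induction hw using Submodule.span_induction with
  | mem w h =>
    obtain ⟨x, n, rfl⟩ := h
    rw [antipode_ι_pow]
    exact Submodule.smul_mem _ _ (τ.ι_pow_mem_symmetrized x.2 n)
  | zero => simp
  | add u v _ _ hu hv => rw [map_add]; exact add_mem hu hv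
  | smul t u _ hu => rw [map_smul]; exact Submodule.smul_mem _ _ hu

/-- The product of `U_τ` as a morphism of coalgebras. -/
noncomputable def mulCoalgHom : τ.Integral ⊗[k] τ.Integral →ₗc[k] τ.Integral where
  toLinearMap := TensorProduct.lift τ.mul
  counit_comp := TensorProduct.ext' fun u v => by
    simp [counit_mul, mul_comm]
  map_comp_comul := TensorProduct.ext' fun u v => (τ.comul_mul u v).symm

/-- The morphism of coalgebras `u ⊗ v ↦ ρ_v ρ_u`. -/
noncomputable def rhoMul : τ.Integral ⊗[k] τ.Integral →ₗc[k] UniversalEnvelopingAlgebra k 𝔤 where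
  toLinearMap := TensorProduct.lift
    ((LinearMap.mul k (UniversalEnvelopingAlgebra k 𝔤)).flip.compl₁₂ τ.rho τ.rho)
  counit_comp := TensorProduct.ext' fun u v => by
    have h : ∀ z, Coalgebra.counit (R := k) (τ.rho z) = Coalgebra.counit (R := k) z := fun z =>
      LinearMap.congr_fun τ.rhoCoalgHom.counit_comp z
    simp only [LinearMap.comp_apply, TensorProduct.lift.tmul, LinearMap.compl₁₂_apply,
      LinearMap.flip_apply, LinearMap.mul_apply', Bialgebra.counit_mul, h,
      TensorProduct.counit_tmul, smul_eq_mul]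
  map_comp_comul := TensorProduct.ext' fun u v => by
    have h : ∀ z, Coalgebra.comul (R := k) (τ.rho z) =
        TensorProduct.map τ.rho τ.rho (Coalgebra.comul (R := k) z) := fun z =>
      (LinearMap.congr_fun τ.rhoCoalgHom.map_comp_comul z).symm
    simp only [LinearMap.comp_apply, TensorProduct.lift.tmul, LinearMap.compl₁₂_apply,
      LinearMap.flip_apply, LinearMap.mul_apply', Bialgebra.comul_mul, h, TensorProduct.comul_tmul]
    hopf_tensor_induction Coalgebra.comul (R := k) u with u₁ u₂
    hopf_tensor_induction Coalgebra.comul (R := k) v with v₁ v₂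
    simp

/-- The morphism of coalgebras `u ⊗ v ↦ ∑ S(ρ_{u₍₁₎v₍₁₎}) ρ_{v₍₂₎} ρ_{u₍₂₎}`. -/
noncomputable def holonomy :
    τ.Integral ⊗[k] τ.Integral →ₗc[k] UniversalEnvelopingAlgebra k 𝔤 :=
  convCoalgHom (antipodeCoalgHom.comp (τ.rhoCoalgHom.comp τ.mulCoalgHom)) τ.rhoMul

/-- Dividing `(x u) v` by `u v` means acting by `S(ρ_{uv}) ρ_v ρ_u`, in Sweedler form. -/
theorem hopf_r : τ.hopf.r = τ.act ∘ₗ τ.holonomy.toLinearMap := by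
  have h : TensorProduct.lift ((LinearMap.mul k (Module.End k τ.Integral)).flip.compl₁₂
      τ.hopf.mul.flip τ.hopf.mul.flip) = τ.act ∘ₗ τ.rhoMul.toLinearMap :=
    TensorProduct.ext' fun u v => (τ.act_mul (τ.rho v) (τ.rho u)).symm
  rw [NonassocHopfAlgebra.r, sweedlerThen_eq, h, holonomy, toLinearMap_convCoalgHom]
  exact congrArg ofConv (τ.act_comp_convMul
    (HopfAlgebra.antipode k ∘ₗ τ.rho ∘ₗ TensorProduct.lift τ.mul) τ.rhoMul.toLinearMap)

/-- Both `ρ_v ρ_u` and `ρ_{uv}` send the class of `1` to `u v`, so the antipode identity for `z = u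
v` applies. -/
theorem act_holonomy_one (w : τ.Integral ⊗[k] τ.Integral) :
    τ.act (τ.holonomy w) τ.one = Coalgebra.counit (R := k) w • τ.one := by
  have h1 : τ.act (τ.holonomy w) τ.one =
      TensorProduct.lift (τ.act ∘ₗ HopfAlgebra.antipode k ∘ₗ τ.rho)
        (TensorProduct.map τ.mulCoalgHom.toLinearMap τ.mulCoalgHom.toLinearMap
          (Coalgebra.comul (R := k) w)) := by
    rw [holonomy, convCoalgHom_apply]
    generalize Coalgebra.comul (R := k) w = t
    induction t with
    | zero => simp
    | add s t hs ht => simp only [map_add, LinearMap.add_apply, hs, ht]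
    | tmul a b =>
      have hb : τ.act (τ.rhoMul b) τ.one = τ.mulCoalgHom b := by
        induction b with
        | zero => simp
        | add s t hs ht => simp only [map_add, LinearMap.add_apply, hs, ht]
        | tmul u v =>
          change τ.act (τ.rho v * τ.rho u) τ.one = τ.mul u v
          rw [act_mul, mul_apply]
          exact congrArg (τ.act (τ.rho v)) (τ.one_mul_apply u)
      rw [TensorProduct.map_tmul, TensorProduct.map_tmul, LinearMap.mul'_apply, act_mul,
        Module.End.mul_apply, TensorProduct.lift.tmul]
      exact congrArg _ hb
  have h2 : ∀ t, TensorProduct.lift (τ.act ∘ₗ HopfAlgebra.antipode k ∘ₗ τ.rho) t =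
      τ.act (LinearMap.mul' k _ (TensorProduct.map (HopfAlgebra.antipode k ∘ₗ τ.rho) τ.rho t))
        τ.one := by
    intro t
    induction t with
    | zero => simp
    | add s t hs ht => simp only [map_add, LinearMap.add_apply, hs, ht]
    | tmul a b =>
      rw [TensorProduct.map_tmul, LinearMap.mul'_apply, act_mul, Module.End.mul_apply,
        TensorProduct.lift.tmul]
      exact congrArg _ (τ.one_mul_apply b).symm
  have h3 : TensorProduct.map τ.mulCoalgHom.toLinearMap τ.mulCoalgHom.toLinearMap
      (Coalgebra.comul (R := k) w) = Coalgebra.comul (R := k) (τ.mulCoalgHom w) :=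
    LinearMap.congr_fun τ.mulCoalgHom.map_comp_comul w
  have h4 : Coalgebra.counit (R := k) (τ.mulCoalgHom w) = Coalgebra.counit (R := k) w :=
    LinearMap.congr_fun τ.mulCoalgHom.counit_comp w
  rw [h1, h3, h2, ← h4, ← τ.act_comp_convOne (τ.mulCoalgHom w) τ.one, ← antipode_rho_convMul_rho]
  rfl

/-- The operation `∘` of `U_τ` defined by a second triple `τ'`. -/
noncomputable def circ : τ.Integral ⊗[k] τ.Integral →ₗc[k] τ.Integral :=
  (Coalgebra.Quotient.mkQCoalgHom τ.leftIdealSubmodule).comp (τ'.antipodeProj.comp τ.holonomy)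

theorem circ_apply (w : τ.Integral ⊗[k] τ.Integral) :
    τ.circ τ' w = τ.leftIdealSubmodule.mkQ (τ'.antipodeProj (τ.holonomy w)) := rfl

theorem circ_eq_of_holonomy_eq {w : τ.Integral ⊗[k] τ.Integral} {t : k}
    (h : τ.holonomy w = algebraMap k _ t) : τ.circ τ' w = t • τ.one := by
  have h1 : τ'.antipodeProj 1 = 1 := by
    rw [antipodeProj_apply]
    exact (congrArg _ τ'.rho_one).trans HopfAlgebra.antipode_one
  rw [circ_apply, h, Algebra.algebraMap_eq_smul_one, map_smul, h1, map_smul, one]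

theorem circ_tmul_one (u : τ.Integral) :
    τ.circ τ' (u ⊗ₜ[k] τ.one) = Coalgebra.counit (R := k) u • τ.one := by
  refine τ.circ_eq_of_holonomy_eq τ' ?_
  have h1 : Coalgebra.comul (R := k) τ.one = τ.one ⊗ₜ[k] τ.one := τ.hopf.comul_one
  have h2 := LinearMap.congr_fun (congrArg ofConv τ.antipode_rho_convMul_rho) u
  refine Eq.trans ?_ h2
  rw [holonomy, convCoalgHom_apply, LinearMap.convMul_apply, TensorProduct.comul_tmul, h1]
  generalize Coalgebra.comul (R := k) u = t
  induction t with
  | zero => simp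
  | add s t hs ht => simp only [map_add, TensorProduct.add_tmul, hs, ht]
  | tmul a b =>
    change HopfAlgebra.antipode k (τ.rho (τ.mul a τ.one)) * (τ.rho τ.one * τ.rho b) =
      HopfAlgebra.antipode k (τ.rho a) * τ.rho b
    rw [mul_one_apply, rho_one, one_mul]

theorem circ_one_tmul (u : τ.Integral) :
    τ.circ τ' (τ.one ⊗ₜ[k] u) = Coalgebra.counit (R := k) u • τ.one := by
  refine τ.circ_eq_of_holonomy_eq τ' ?_
  have h1 : Coalgebra.comul (R := k) τ.one = τ.one ⊗ₜ[k] τ.one := τ.hopf.comul_one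
  have h2 := LinearMap.congr_fun (congrArg ofConv τ.antipode_rho_convMul_rho) u
  refine Eq.trans ?_ h2
  rw [holonomy, convCoalgHom_apply, LinearMap.convMul_apply, TensorProduct.comul_tmul, h1]
  generalize Coalgebra.comul (R := k) u = t
  induction t with
  | zero => simp
  | add s t hs ht => simp only [map_add, TensorProduct.tmul_add, hs, ht]
  | tmul a b =>
    change HopfAlgebra.antipode k (τ.rho (τ.mul τ.one a)) * (τ.rho b * τ.rho τ.one) =
      HopfAlgebra.antipode k (τ.rho a) * τ.rho b
    rw [one_mul_apply, rho_one, mul_one]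

/-- The morphism of coalgebras `u ⊗ v ↦ h(u,v)` through which `H(u,v)` acts. -/
noncomputable def hypoElement :
    τ.Integral ⊗[k] τ.Integral →ₗc[k] UniversalEnvelopingAlgebra k 𝔤 :=
  τ'.envelopeProj.comp τ.holonomy

theorem hypoElement_mem (w : τ.Integral ⊗[k] τ.Integral) : τ.hypoElement τ' w ∈ τ'.envelope :=
  τ'.envelopeProj_mem _

theorem toLinearMap_hypoElement : (τ.hypoElement τ').toLinearMap =
    (toConv (τ'.antipodeProj.toLinearMap ∘ₗ τ.holonomy.toLinearMap) *
      toConv τ.holonomy.toLinearMap).ofConv :=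
  LinearMap.convMul_comp_coalgHom_distrib (toConv τ'.antipodeProj.toLinearMap)
    (toConv LinearMap.id) τ.holonomy

/-- In `∑ S(ρ'(h₍₁₎)) h₍₂₎`, the second factor acts on the class of `1` by the counit, leaving the
class of `S(ρ'(h))`. -/
theorem mkQ_hypoElement (w : τ.Integral ⊗[k] τ.Integral) :
    τ.leftIdealSubmodule.mkQ (τ.hypoElement τ' w) = τ.circ τ' w := by
  have h1 : τ.hypoElement τ' w = LinearMap.mul' k _ (TensorProduct.map
      (τ'.antipodeProj.toLinearMap ∘ₗ τ.holonomy.toLinearMap) τ.holonomy.toLinearMap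
        (Coalgebra.comul (R := k) w)) :=
    LinearMap.congr_fun (τ.toLinearMap_hypoElement τ') w
  have h2 : ∀ t, τ.leftIdealSubmodule.mkQ (LinearMap.mul' k _ (TensorProduct.map
      (τ'.antipodeProj.toLinearMap ∘ₗ τ.holonomy.toLinearMap) τ.holonomy.toLinearMap t)) =
      τ.circ τ' (TensorProduct.rid k _ (LinearMap.lTensor _ (Coalgebra.counit (R := k)) t)) := by
    intro t
    induction t with
    | zero => simp
    | add s t hs ht => simp only [map_add, hs, ht]
    | tmul a b =>
      rw [TensorProduct.map_tmul, LinearMap.mul'_apply, ← act_mk, LinearMap.lTensor_tmul,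
        TensorProduct.rid_tmul, map_smul]
      have hb : τ.leftIdealSubmodule.mkQ (τ.holonomy.toLinearMap b) =
          Coalgebra.counit (R := k) b • τ.one := by
        rw [← act_holonomy_one, one, act_mk, mul_one]; rfl
      rw [hb, map_smul, one, act_mk, mul_one]
      rfl
  rw [h1, h2, Coalgebra.lTensor_counit_comul, TensorProduct.rid_tmul, one_smul]

/-- The map `u ↦ (y ↦ Ad(u)(ρ_y) 1)`. -/
noncomputable def conj : UniversalEnvelopingAlgebra k 𝔤 →ₗ[k] Module.End k τ.Integral :=
  (adjointAction.toLinearMap.compl₂ τ.rho).compr₂ τ.leftIdealSubmodule.mkQ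

variable {τ τ'}

theorem rho_conj (hs : τ'.s ≤ normalizer τ.c) {u : UniversalEnvelopingAlgebra k 𝔤}
    (hu : u ∈ τ'.envelope) (y : τ.Integral) : τ.rho (τ.conj u y) = adjointAction u (τ.rho y) :=
  τ.rho_mkQ (adjointAction_mem_symmetrized hs hu (τ.rho_mem y))

theorem hypoElement_mul_rho (w : τ.Integral ⊗[k] τ.Integral) (y : τ.Integral) :
    τ.hypoElement τ' w * τ.rho y =
      TensorProduct.lift ((LinearMap.mul k (UniversalEnvelopingAlgebra k 𝔤)) ∘ₗ
        adjointAction.toLinearMap.flip (τ.rho y))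
        (TensorProduct.map (τ.hypoElement τ').toLinearMap (τ.hypoElement τ').toLinearMap
          (Coalgebra.comul (R := k) w)) := by
  rw [← adjointAction_mul_comul]
  exact congrArg _ (LinearMap.congr_fun (τ.hypoElement τ').map_comp_comul w).symm

/-- `S(ρ'(h))` is symmetrized over `𝔠'`, hence over `𝔠`, so `ρ` recovers it from its class. This is
where `𝔠' ⊆ 𝔠` matters. -/
theorem rho_circ (hc : τ'.c ≤ τ.c) (w : τ.Integral ⊗[k] τ.Integral) :
    τ.rho (τ.circ τ' w) = τ'.antipodeProj (τ.holonomy w) :=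
  τ.rho_mkQ (symmetrized_mono hc (τ'.antipode_mem_symmetrized (τ'.rho_mem _)))

theorem hopf_hypoH (hc : τ'.c ≤ τ.c) :
    τ.hopf.hypoH (τ.circ τ').toLinearMap = τ.act ∘ₗ (τ.hypoElement τ').toLinearMap := by
  have h : τ.hopf.mul.flip ∘ₗ (τ.circ τ').toLinearMap =
      τ.act ∘ₗ τ'.antipodeProj.toLinearMap ∘ₗ τ.holonomy.toLinearMap :=
    LinearMap.ext fun w => congrArg τ.act (rho_circ hc w)
  rw [NonassocHopfAlgebra.hypoH, sweedlerThen_eq, hopf_r, h, toLinearMap_hypoElement]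
  exact congrArg ofConv (τ.act_comp_convMul _ _)

theorem hopf_hypoH' (hs : τ'.s ≤ normalizer τ.c) (hc : τ'.c ≤ τ.c) :
    τ.hopf.hypoH' (τ.circ τ').toLinearMap = τ.conj ∘ₗ (τ.hypoElement τ').toLinearMap := by
  -- Evaluating `g ρ_y = ∑ Ad(g₍₁₎)(ρ_y) g₍₂₎` at the class of `1` expresses `H(y)` as `u ∘ v` times
  -- the conjugate of `y`, in Sweedler form.
  have h : toConv (τ.act ∘ₗ (τ.hypoElement τ').toLinearMap) =
      toConv (τ.mul ∘ₗ (τ.circ τ').toLinearMap) *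
        toConv (τ.conj ∘ₗ (τ.hypoElement τ').toLinearMap) := by
    refine ofConv_injective (LinearMap.ext fun w => LinearMap.ext fun y => ?_)
    have h1 : (toConv (τ.act ∘ₗ (τ.hypoElement τ').toLinearMap)).ofConv w y =
        τ.leftIdealSubmodule.mkQ (τ.hypoElement τ' w * τ.rho y) := by
      conv_lhs => rw [← τ.mkQ_rho y]
      rfl
    rw [h1, hypoElement_mul_rho, LinearMap.convMul_apply]
    conv_rhs => rw [← Coalgebra.comm_comul k w]
    generalize Coalgebra.comul (R := k) w = t
    induction t with
    | zero => simp
    | add s t hs ht => simp only [map_add, LinearMap.add_apply, hs, ht]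
    | tmul a b =>
      change τ.leftIdealSubmodule.mkQ (adjointAction (τ.hypoElement τ' a) (τ.rho y) *
        τ.hypoElement τ' b) = τ.mul (τ.circ τ' b) (τ.conj (τ.hypoElement τ' a) y)
      rw [← act_mk, mkQ_hypoElement, mul_apply, rho_conj hs (τ.hypoElement_mem τ' a)]
  -- As `∘` is a coalgebra morphism, convolution with left division by `u ∘ v` cancels the factor `u
  -- ∘ v`.
  have h2 : toConv (τ.ldiv ∘ₗ (τ.circ τ').toLinearMap) *
      toConv (τ.mul ∘ₗ (τ.circ τ').toLinearMap) = 1 := by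
    have := LinearMap.convMul_comp_coalgHom_distrib (toConv τ.ldiv) (toConv τ.mul) (τ.circ τ')
    rw [ldiv_convMul_mul] at this
    refine Eq.trans (congrArg toConv this.symm) ?_
    exact congrArg (fun f => toConv (Algebra.linearMap k _ ∘ₗ f)) (τ.circ τ').counit_comp
  rw [NonassocHopfAlgebra.hypoH', sweedlerComp_eq, hopf_hypoH hc, h]
  refine (congrArg ofConv
    (mul_assoc (toConv (τ.ldiv ∘ₗ (τ.circ τ').toLinearMap)) _ _).symm).trans ?_
  rw [h2, one_mul]

/-- The same identity for `g ρ_y`, now evaluated at `x`: the conjugate of `ρ_y` is again a `ρ`, so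
it acts as a right multiplication. Cocommutativity exchanges the two factors. -/
theorem hopf_hypoH_mul (hs : τ'.s ≤ normalizer τ.c) (hc : τ'.c ≤ τ.c)
    (w : τ.Integral ⊗[k] τ.Integral) (x y : τ.Integral) :
    τ.hopf.hypoH (τ.circ τ').toLinearMap w (τ.mul x y) =
      sweedler τ.mul ((τ.hopf.hypoH (τ.circ τ').toLinearMap).flip x)
        ((τ.hopf.hypoH' (τ.circ τ').toLinearMap).flip y) w := by
  rw [hopf_hypoH' hs hc, hopf_hypoH hc]
  have h1 : (τ.act ∘ₗ (τ.hypoElement τ').toLinearMap) w (τ.mul x y) =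
      τ.act (τ.hypoElement τ' w * τ.rho y) x := by
    rw [act_mul]; rfl
  rw [h1, hypoElement_mul_rho, sweedler, LinearMap.comp_apply, LinearMap.comp_apply]
  conv_rhs => rw [← Coalgebra.comm_comul k w]
  generalize Coalgebra.comul (R := k) w = t
  induction t with
  | zero => simp
  | add s t hs ht => simp only [map_add, LinearMap.add_apply, hs, ht]
  | tmul a b =>
    change τ.act (adjointAction (τ.hypoElement τ' a) (τ.rho y) * τ.hypoElement τ' b) x =
      τ.mul (τ.act (τ.hypoElement τ' b) x) (τ.conj (τ.hypoElement τ' a) y)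
    rw [mul_apply, rho_conj hs (τ.hypoElement_mem τ' a), act_mul]
    rfl

theorem hopf_rightHypospecial (hs : τ'.s ≤ normalizer τ.c) (hc : τ'.c ≤ τ.c) :
    τ.hopf.RightHypospecial :=
  ⟨τ.circ τ', τ.circ_tmul_one τ', τ.circ_one_tmul τ',
    fun u v x y => hopf_hypoH_mul hs hc (u ⊗ₜ[k] v) x y⟩

end LieTriple

/-- If `τ = (𝔤, 𝔰, 𝔠)` is a hyporeductive triple over a field of characteristic zero, then the
coalgebra `U_τ = U(𝔤) / U(𝔤) 𝔰`, with its product and unit, is a hyporeductive Hopf algebra. -/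
theorem mainTheorem2 {k 𝔤 : Type*} [Field k] [CharZero k] [LieRing 𝔤] [LieAlgebra k 𝔤]
    (τ : LieTriple k 𝔤) (hτ : τ.IsHyporeductive) :
    ∃ A : NonassocHopfAlgebra k τ.Integral,
      A.mul = τ.mul ∧ A.one = τ.one ∧ A.IsHyporeductive := by
  obtain ⟨τ', hs, hc⟩ := hτ.exists_triple
  exact ⟨τ.hopf, rfl, rfl, LieTriple.hopf_rightHypospecial hs.le hc, τ.hopf_rightMonoalternative⟩
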